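/- Let $\xi=\{\xi(k)\}_{k\in\mathbb Z}$ be i.i.d. non-negative random variables with $\lambda_1=\mathbb E[\xi(0)]\in(0,\infty)$ and $\sigma^2=\operatorname{Var}[\xi(0)]\in(0,\infty)$, $\sigma>0$; let $a>0$, and let $b=\{b(j)\}_{j\ge1}$ be a non-negative sequence that is not identically zero. Put $B=\sum_{j\ge1}b(j)$, and let $z(j)$, $j\ge 0$, be the coefficients of the power series $$\frac1{1-\lambda_1\sum_{j\ge1}b(j)t^j}=\sum_{j\ge0}z(j)t^j .$$ Assume (S1) $\lambda_1B<1$ (in particular $B<\infty$); (S2) $\dfrac{\sigma}{\lambda_1}\Bigl(\sum_{j\ge1}z(j)^2\Bigr)^{1/2}<1$. Let $X=\{X(k)\}_{k\in\mathbb Z}$ be a weakly stationary solution of the ARCH($\infty$) equations $$X(k)=\varsigma(k)\,\xi(k),\qquad \varsigma(k)=a+\sum_{j=1}^\infty b(j)X(k-j)\qquad\text{a.s., }k\in\mathbb Z,$$ that is, a solution with finite second moments, constant mean, and $\operatorname{Cov}[X(n),X(n+k)]=\rho(k)$ for all $n,k\in\mathbb Z$. Then $\rho(k)\ge0$ for all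 $k$ and, with $\log0=-\infty$, the following hold for every $\beta\in(1,\infty)\cup\{\infty\}$. (i) If $\displaystyle\lim_{n\to\infty}\frac{\log b(n)}{\log n}=-\beta$, then $\displaystyle\lim_{n\to\infty}\frac{\log\rho(n)}{\log n}=-\beta$. (ii) $\displaystyle\limsup_{n\to\infty}\frac{\log b(n)}{\log n}=-\beta$ if and only if $\displaystyle\limsup_{n\to\infty}\frac{\log\rho(n)}{\log n}=-\beta$. -/

import Mathlib

open MeasureTheory ProbabilityTheory Filter Topology

noncomputable section

namespace ArchInfty

/-- The conditional volatility `ς(k) = a + ∑_{j ≥ 1} b(j) X(k - j)`.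
A kernel `b = {b(j) : j ≥ 1}` is a function on `ℕ` whose value at `0` is never used; a sum over
`j ≥ 1` is written as a sum over `j : ℕ` with `j + 1` in place of `j`. -/
def volatility {S : Type*} (a : ℝ) (b : ℕ → ℝ) (X : ℤ → S → ℝ) (k : ℤ) (s : S) : ℝ :=
  a + ∑' j : ℕ, b (j + 1) * X (k - ((j : ℤ) + 1)) s

/-- `X` satisfies the ARCH(∞) equations with data `a`, `b` and shocks `ξ`: the shocks are
i.i.d. non-negative random variables, `a ≥ 0`, `b(j) ≥ 0`, and almost surely
`X(k) = ς(k) ξ(k)`, the series defining `ς(k)` being convergent. -/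
structure IsSolution {S : Type*} [MeasurableSpace S] (P : Measure S)
    (a : ℝ) (b : ℕ → ℝ) (ξ X : ℤ → S → ℝ) : Prop where
  a_nonneg : 0 ≤ a
  b_nonneg : ∀ j : ℕ, 1 ≤ j → 0 ≤ b j
  shock_measurable : ∀ k, Measurable (ξ k)
  shock_nonneg : ∀ k, ∀ᵐ s ∂P, 0 ≤ ξ k s
  shock_indep : iIndepFun ξ P
  shock_ident : ∀ k, IdentDistrib (ξ k) (ξ 0) P P
  summable : ∀ k : ℤ, ∀ᵐ s ∂P, Summable fun j : ℕ => b (j + 1) * X (k - ((j : ℤ) + 1)) s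
  equation : ∀ k : ℤ, ∀ᵐ s ∂P, X k s = volatility a b X k s * ξ k s

/-- `X` is weakly stationary with autocovariance function `ρ`: finite second moments, constant
mean, and `Cov[X(n), X(n + k)] = ρ(k)` for all `n, k ∈ ℤ`. -/
structure IsWeaklyStationary {S : Type*} [MeasurableSpace S] (P : Measure S)
    (X : ℤ → S → ℝ) (ρ : ℤ → ℝ) : Prop where
  memLp : ∀ k, MemLp (X k) 2 P
  mean_const : ∀ n, ∫ s, X n s ∂P = ∫ s, X 0 s ∂P
  cov_eq : ∀ n k : ℤ, cov[X n, X (n + k); P] = ρ k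

/-- `λ₁ = E[ξ(0)]`. -/
def lam {S : Type*} [MeasurableSpace S] (P : Measure S) (ξ : ℤ → S → ℝ) : ℝ :=
  ∫ s, ξ 0 s ∂P

/-- `σ = Var[ξ(0)]^{1/2}`. -/
def sigma {S : Type*} [MeasurableSpace S] (P : Measure S) (ξ : ℤ → S → ℝ) : ℝ :=
  Real.sqrt (variance (ξ 0) P)

/-- The coefficients `z(n)` of the power series of `1 / ψ`, where
`ψ(t) = 1 - l ∑_{j ≥ 1} b(j) t^j`. -/
def z (l : ℝ) (b : ℕ → ℝ) (n : ℕ) : ℝ :=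
  PowerSeries.coeff n
    ((PowerSeries.mk fun j : ℕ => if j = 0 then (1 : ℝ) else -(l * b j))⁻¹)

/-- The standing hypothesis: `λ₁ ∈ (0, ∞)`, `a > 0`, `σ ∈ (0, ∞)` and `b ≢ 0`. Finiteness of
`λ₁` and `σ` is square integrability of `ξ(0)`. -/
structure CondS0 {S : Type*} [MeasurableSpace S] (P : Measure S)
    (a : ℝ) (b : ℕ → ℝ) (ξ : ℤ → S → ℝ) : Prop where
  memLp : MemLp (ξ 0) 2 P
  lam_pos : 0 < lam P ξ
  a_pos : 0 < a
  sigma_pos : 0 < sigma P ξ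
  b_ne_zero : ∃ j : ℕ, 1 ≤ j ∧ b j ≠ 0

/-- `λ₁ B < 1`, where `B = ∑_{j ≥ 1} b(j)` is finite. -/
def CondS1 {S : Type*} [MeasurableSpace S] (P : Measure S) (b : ℕ → ℝ) (ξ : ℤ → S → ℝ) : Prop :=
  (Summable fun j : ℕ => b (j + 1)) ∧ lam P ξ * ∑' j : ℕ, b (j + 1) < 1

/-- `(σ / λ₁) (∑_{j ≥ 1} z(j)²)^{1/2} < 1`, the series being finite. -/
def CondS2 {S : Type*} [MeasurableSpace S] (P : Measure S) (b : ℕ → ℝ) (ξ : ℤ → S → ℝ) : Prop :=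
  (Summable fun j : ℕ => z (lam P ξ) b (j + 1) ^ 2) ∧
    sigma P ξ / lam P ξ * Real.sqrt (∑' j : ℕ, z (lam P ξ) b (j + 1) ^ 2) < 1

/-- `log u(n) / log n` for a non-negative sequence `u`, as an extended real number, with
`log 0 = -∞`. (Only large `n` matter below, for which `log n > 0`.) -/
def logRatio (u : ℕ → ℝ) (n : ℕ) : EReal :=
  ENNReal.log (ENNReal.ofReal (u n)) / ((Real.log n : ℝ) : EReal)

end ArchInfty

end

open MeasureTheory ProbabilityTheory Filter Topology
open Finset.HasAntidiagonal (antidiagonal)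
open scoped ENNReal

namespace ArchInfty

/-! Write `ζ(k) = ξ(k) - λ₁` and `η(k) = ζ(k) ς(k)`. The equations say that convolving `X` with the
coefficients of `ψ(t) = 1 - λ₁ ∑ b(j) t^j` gives `λ₁ a + η`. Inverting `ψ` yields `X(k) = const + ∑
z(j) η(k - j)`. If the `η(k)` are centred and orthogonal with common variance `s > 0`, then `ρ(n) =
s ∑ z(i) z(i + n)` (`autocovariance_eq`). From `z(0) = 1` and `z(n) ≥ λ₁ b(n)` follows `ρ(n) ≥ s λ₁
b(n)`. Conversely, a power bound on `b` passes to `z` because `λ₁ B < 1` (`z_le_rpow`), and then to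
`ρ`. Constant factors are invisible to logarithmic ratios.

The difficulty is orthogonality, since causality of the solution is not assumed. The inverted
equation gives `ς(k) = α + ∑ c(j) ζ(k-j) ς(k-j)` with `c = z / λ₁`. After `n` substitutions the
remainder is `∑ Q_n(d) ς(k-d)`, where `Q_n(d)` is a polynomial in past shocks. No independence of
`Q_n(d)` and `ς(k-d)` is known, so Cauchy-Schwarz bounds the remainder in L¹ by a multiple of `∑
‖Q_n(d)‖₂`. Since the shocks are centred and independent, `‖Q_n(d)‖₂²` is the coefficient of `t^d`
in `f^n`, where `f = σ² ∑ c(j)² t^j`. (S2) says that the coefficients of `f` sum to less than one,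
and summability of `z` makes their square roots summable. Then `tendsto_sqrtSum_pow` sends the
remainder to zero, and `ς(k)` is a function of past shocks (`exists_volatility_ae_eq`). -/

/-! ### Square roots of the coefficients of powers of a series. -/

/-- The sum of all coefficients of a power series over `[0, ∞]`. -/
noncomputable def coeffSum (f : PowerSeries ℝ≥0∞) : ℝ≥0∞ := ∑' n, PowerSeries.coeff n f

/-- The sum of the square roots of the coefficients of a power series over `[0, ∞]`. -/
noncomputable def sqrtSum (f : PowerSeries ℝ≥0∞) : ℝ≥0∞ :=
  ∑' n, PowerSeries.coeff n f ^ (1 / 2 : ℝ)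

lemma tsum_antidiagonal_eq_mul (f g : ℕ → ℝ≥0∞) :
    ∑' n, ∑ p ∈ antidiagonal n, f p.1 * g p.2 = (∑' n, f n) * ∑' n, g n := by
  have h1 : (∑' n, f n) * ∑' n, g n = ∑' p : ℕ × ℕ, f p.1 * g p.2 := by
    rw [ENNReal.tsum_prod', ← ENNReal.tsum_mul_right]
    simp_rw [ENNReal.tsum_mul_left]
  rw [h1, ← Finset.HasAntidiagonal.sigmaAntidiagonalEquivProd.tsum_eq, ENNReal.tsum_sigma']
  refine tsum_congr fun n => ?_
  rw [tsum_fintype, ← Finset.sum_coe_sort]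
  rfl

lemma ennreal_sum_rpow_half_le {ι : Type*} (s : Finset ι) (f : ι → ℝ≥0∞) :
    (∑ i ∈ s, f i) ^ (1 / 2 : ℝ) ≤ ∑ i ∈ s, f i ^ (1 / 2 : ℝ) := by
  classical
  induction s using Finset.induction_on with
  | empty => simp
  | insert i s hi ih =>
    rw [Finset.sum_insert hi, Finset.sum_insert hi]
    exact (ENNReal.rpow_add_le_add_rpow _ _ (by norm_num) (by norm_num)).trans
      (add_le_add_right ih _)

lemma coeffSum_mul (f g : PowerSeries ℝ≥0∞) : coeffSum (f * g) = coeffSum f * coeffSum g := by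
  unfold coeffSum
  simp_rw [PowerSeries.coeff_mul]
  exact tsum_antidiagonal_eq_mul (fun n => PowerSeries.coeff n f) fun n => PowerSeries.coeff n g

lemma coeffSum_one : coeffSum 1 = 1 := by
  unfold coeffSum
  rw [tsum_eq_single 0 (fun n hn => by simp [PowerSeries.coeff_one, hn])]
  simp

lemma coeffSum_pow (f : PowerSeries ℝ≥0∞) (n : ℕ) : coeffSum (f ^ n) = coeffSum f ^ n := by
  induction n with
  | zero => simp [coeffSum_one]
  | succ n ih => rw [pow_succ, coeffSum_mul, ih, pow_succ]

/-- The square root is multiplicative and subadditive. This alone gives no decay of powers, because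
`sqrtSum f` may exceed one. -/
lemma sqrtSum_mul_le (f g : PowerSeries ℝ≥0∞) : sqrtSum (f * g) ≤ sqrtSum f * sqrtSum g := by
  unfold sqrtSum
  rw [← tsum_antidiagonal_eq_mul]
  refine ENNReal.tsum_le_tsum fun n => ?_
  rw [PowerSeries.coeff_mul]
  refine (ennreal_sum_rpow_half_le _ _).trans (Finset.sum_le_sum fun p _ => ?_)
  rw [ENNReal.mul_rpow_of_nonneg _ _ (by norm_num)]

lemma sqrtSum_one : sqrtSum 1 = 1 := by
  unfold sqrtSum
  rw [tsum_eq_single 0 (fun n hn => by simp [PowerSeries.coeff_one, hn])]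
  simp

lemma sqrtSum_pow_le (f : PowerSeries ℝ≥0∞) (n : ℕ) : sqrtSum (f ^ n) ≤ sqrtSum f ^ n := by
  induction n with
  | zero => simp [sqrtSum_one]
  | succ n ih =>
    rw [pow_succ, pow_succ]
    exact (sqrtSum_mul_le _ _).trans (mul_le_mul_left ih _)

lemma sqrtSum_sum_le {ι : Type*} (s : Finset ι) (f : ι → PowerSeries ℝ≥0∞) :
    sqrtSum (∑ i ∈ s, f i) ≤ ∑ i ∈ s, sqrtSum (f i) := by
  unfold sqrtSum
  rw [← Summable.tsum_finsetSum (fun i _ => ENNReal.summable)]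
  refine ENNReal.tsum_le_tsum fun n => ?_
  rw [map_sum]
  exact ennreal_sum_rpow_half_le _ _

lemma sqrtSum_mul_natCast (f : PowerSeries ℝ≥0∞) (c : ℕ) :
    sqrtSum (f * (c : PowerSeries ℝ≥0∞)) = sqrtSum f * (c : ℝ≥0∞) ^ (1 / 2 : ℝ) := by
  unfold sqrtSum
  rw [← ENNReal.tsum_mul_right]
  refine tsum_congr fun n => ?_
  have : (c : PowerSeries ℝ≥0∞) = PowerSeries.C (c : ℝ≥0∞) := by simp
  rw [this, PowerSeries.coeff_mul_C, ENNReal.mul_rpow_of_nonneg _ _ (by norm_num)]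

lemma coeff_pow_eq_zero {f : PowerSeries ℝ≥0∞} {L : ℕ}
    (hf : ∀ n, L < n → PowerSeries.coeff n f = 0) (m n : ℕ) (hn : L * m < n) :
    PowerSeries.coeff n (f ^ m) = 0 := by
  induction m generalizing n with
  | zero => rw [pow_zero, PowerSeries.coeff_one, if_neg (by omega)]
  | succ m ih =>
    rw [pow_succ, PowerSeries.coeff_mul]
    refine Finset.sum_eq_zero fun p hp => ?_
    rw [Finset.HasAntidiagonal.mem_antidiagonal] at hp
    by_cases h : L * m < p.1
    · rw [ih _ h, zero_mul]
    · rw [hf p.2 (by rw [mul_add, mul_one] at hn; omega), mul_zero]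

/-- There are at most `D + 1` nonzero coefficients, each at most `coeffSum f`. So for polynomials
the passage to square roots costs only a factor linear in the degree. -/
lemma sqrtSum_le_of_coeff_eq_zero {f : PowerSeries ℝ≥0∞} {D : ℕ}
    (hf : ∀ n, D < n → PowerSeries.coeff n f = 0) :
    sqrtSum f ≤ (D + 1 : ℕ) * coeffSum f ^ (1 / 2 : ℝ) := by
  unfold sqrtSum
  rw [tsum_eq_sum (s := Finset.range (D + 1))]
  · refine (Finset.sum_le_card_nsmul _ _ (coeffSum f ^ (1 / 2 : ℝ)) fun n _ => ?_).trans ?_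
    · exact ENNReal.rpow_le_rpow (ENNReal.le_tsum n) (by norm_num)
    · simp
  · intro n hn
    rw [Finset.mem_range, not_lt] at hn
    rw [hf n (by omega)]
    simp

/-- In the binomial expansion, powers of `f` are controlled by their degree and powers of `g` by
submultiplicativity. Apart from the degree factor, each summand is then bounded by the square root
of one term in the expansion of `(coeffSum f + sqrtSum g ^ 2) ^ n`, hence by the root of the whole.
-/
lemma sqrtSum_add_pow_le {f g : PowerSeries ℝ≥0∞} {L : ℕ}
    (hf : ∀ n, L < n → PowerSeries.coeff n f = 0) (n : ℕ) :
    sqrtSum ((f + g) ^ n) ≤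
      (n + 1 : ℕ) * ((L * n + 1 : ℕ) * ((coeffSum f + sqrtSum g ^ 2) ^ n) ^ (1 / 2 : ℝ)) := by
  rw [add_pow]
  refine (sqrtSum_sum_le _ _).trans ((Finset.sum_le_card_nsmul _ _
    ((L * n + 1 : ℕ) * ((coeffSum f + sqrtSum g ^ 2) ^ n) ^ (1 / 2 : ℝ)) fun m hm => ?_).trans
      (by simp))
  have hmn : m ≤ n := by simpa [Nat.lt_succ_iff] using hm
  rw [sqrtSum_mul_natCast]
  have h1 : sqrtSum (f ^ m) ≤ (L * n + 1 : ℕ) * (coeffSum f ^ m) ^ (1 / 2 : ℝ) := by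
    refine (sqrtSum_le_of_coeff_eq_zero (coeff_pow_eq_zero hf m)).trans ?_
    rw [coeffSum_pow]
    gcongr
  have h2 : sqrtSum (g ^ (n - m)) ≤ ((sqrtSum g ^ 2) ^ (n - m)) ^ (1 / 2 : ℝ) := by
    refine (sqrtSum_pow_le _ _).trans_eq ?_
    rw [← pow_mul, mul_comm, pow_mul, ← ENNReal.rpow_natCast (sqrtSum g ^ (n - m)) 2,
      ← ENNReal.rpow_mul]
    norm_num
  calc sqrtSum (f ^ m * g ^ (n - m)) * (n.choose m : ℝ≥0∞) ^ (1 / 2 : ℝ)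
      ≤ ((L * n + 1 : ℕ) * (coeffSum f ^ m) ^ (1 / 2 : ℝ) *
          ((sqrtSum g ^ 2) ^ (n - m)) ^ (1 / 2 : ℝ)) * (n.choose m : ℝ≥0∞) ^ (1 / 2 : ℝ) := by
        gcongr
        exact (sqrtSum_mul_le _ _).trans (mul_le_mul' h1 h2)
    _ = (L * n + 1 : ℕ) *
          (coeffSum f ^ m * (sqrtSum g ^ 2) ^ (n - m) * (n.choose m : ℝ≥0∞)) ^ (1 / 2 : ℝ) := by
        rw [ENNReal.mul_rpow_of_nonneg _ _ (by norm_num),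
          ENNReal.mul_rpow_of_nonneg _ _ (by norm_num)]
        ring
    _ ≤ _ := by
        gcongr
        rw [add_pow]
        exact Finset.single_le_sum
          (f := fun m => coeffSum f ^ m * (sqrtSum g ^ 2) ^ (n - m) * (n.choose m : ℝ≥0∞))
          (fun _ _ => zero_le) hm

/-- If a non-negative sequence has sum less than one and summable square roots, then the sums of
the square roots of its convolution powers tend to zero. -/
theorem tendsto_sqrtSum_pow {f : PowerSeries ℝ≥0∞} (h1 : coeffSum f < 1) (h2 : sqrtSum f ≠ ∞) :
    Tendsto (fun n : ℕ => sqrtSum (f ^ n)) atTop (𝓝 0) := by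
  -- `ε` bounds the square-root sum of the tail `f₂` cut off below. The resulting geometric rate is
  -- the root of `coeffSum f + ε ^ 2`.
  obtain ⟨ε, hε0, hε⟩ : ∃ ε : ℝ≥0∞, 0 < ε ∧ coeffSum f + ε ^ 2 < 1 := by
    have hc : Tendsto (fun ε : ℝ≥0∞ => coeffSum f + ε ^ 2) (𝓝[>] 0) (𝓝 (coeffSum f + 0 ^ 2)) :=
      (tendsto_const_nhds.add (ENNReal.Tendsto.pow tendsto_id)).mono_left nhdsWithin_le_nhds
    have := hc.eventually_lt_const (u := 1) (by simpa using h1)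
    obtain ⟨ε, h, h'⟩ := (this.and self_mem_nhdsWithin).exists
    exact ⟨ε, h', h⟩
  have htail := ENNReal.tendsto_sum_nat_add (fun n => PowerSeries.coeff n f ^ (1 / 2 : ℝ)) h2
  obtain ⟨L, hL⟩ := (htail.eventually_lt_const hε0).exists
  set f₁ : PowerSeries ℝ≥0∞ := PowerSeries.mk fun n => if n < L then PowerSeries.coeff n f else 0
    with hf₁
  set f₂ : PowerSeries ℝ≥0∞ := PowerSeries.mk fun n => if n < L then 0 else PowerSeries.coeff n f
    with hf₂
  have hf : f = f₁ + f₂ := by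
    ext n
    simp only [hf₁, hf₂, map_add, PowerSeries.coeff_mk]
    split_ifs <;> simp
  have hS1 : coeffSum f₁ ≤ coeffSum f := by
    refine ENNReal.tsum_le_tsum fun n => ?_
    simp only [hf₁, PowerSeries.coeff_mk]
    split_ifs <;> simp
  have hS2 : sqrtSum f₂ ≤ ε := by
    refine le_trans (le_of_eq ?_) hL.le
    unfold sqrtSum
    rw [← ENNReal.summable.sum_add_tsum_nat_add' (k := L), Finset.sum_eq_zero, zero_add]
    · refine tsum_congr fun n => ?_
      simp [hf₂]
    · intro n hn
      simp [hf₂, Finset.mem_range.1 hn]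
  have hv : ∀ n, L < n → PowerSeries.coeff n f₁ = 0 := by
    intro n hn
    simp only [hf₁, PowerSeries.coeff_mk]
    rw [if_neg (by omega)]
  set q : ℝ≥0∞ := coeffSum f + ε ^ 2 with hq
  have hqt : q ≠ ∞ := (hε.trans ENNReal.one_lt_top).ne
  set r : ℝ := (q ^ (1 / 2 : ℝ)).toReal with hr
  have hqr : q ^ (1 / 2 : ℝ) = ENNReal.ofReal r :=
    (ENNReal.ofReal_toReal (ENNReal.rpow_ne_top_of_nonneg (by norm_num) hqt)).symm
  have hr0 : 0 ≤ r := ENNReal.toReal_nonneg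
  have hr1 : r < 1 := by
    have : q ^ (1 / 2 : ℝ) < 1 := ENNReal.rpow_lt_one hε (by norm_num)
    rw [hqr] at this
    simpa using this
  have hbound : ∀ n : ℕ, sqrtSum (f ^ n) ≤
      ENNReal.ofReal (((n : ℝ) + 1) * ((L * n + 1) * r ^ n)) := by
    intro n
    rw [hf]
    refine (sqrtSum_add_pow_le hv n).trans ?_
    have h3 : ((coeffSum f₁ + sqrtSum f₂ ^ 2) ^ n) ^ (1 / 2 : ℝ) ≤ ENNReal.ofReal (r ^ n) := by
      rw [ENNReal.ofReal_pow hr0, ← hqr, ← ENNReal.rpow_natCast _ n, ← ENNReal.rpow_natCast _ n,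
        ← ENNReal.rpow_mul, ← ENNReal.rpow_mul, mul_comm (1 / 2 : ℝ)]
      refine ENNReal.rpow_le_rpow ?_ (by positivity)
      rw [hq]
      gcongr
    rw [ENNReal.ofReal_mul (by positivity), ENNReal.ofReal_mul (by positivity)]
    have e1 : ((n + 1 : ℕ) : ℝ≥0∞) = ENNReal.ofReal ((n : ℝ) + 1) := by
      rw [← ENNReal.ofReal_natCast]; push_cast; rfl
    have e2 : ((L * n + 1 : ℕ) : ℝ≥0∞) = ENNReal.ofReal ((L : ℝ) * n + 1) := by
      rw [← ENNReal.ofReal_natCast]; push_cast; rfl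
    rw [e1, e2]
    gcongr
  refine tendsto_of_tendsto_of_tendsto_of_le_of_le tendsto_const_nhds ?_ (fun _ => zero_le) hbound
  -- `(n + 1)(L n + 1) = L n² + (L + 1) n + 1`, each power of `n` being beaten by `r ^ n`.
  have t (k : ℕ) := tendsto_pow_const_mul_const_pow_of_abs_lt_one k (abs_lt.2 ⟨by linarith, hr1⟩)
  have := (((t 2).const_mul (L : ℝ)).add ((t 1).const_mul (L + 1 : ℝ))).add (t 0)
  rw [← ENNReal.ofReal_zero]
  refine ENNReal.tendsto_ofReal ?_
  convert this using 2
  · ring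
  · simp

/-! ### The renewal sequence `z` and its decay. -/

/-- The coefficients of `ψ(t) = 1 - l ∑_{j ≥ 1} b(j) t^j`. -/
noncomputable def psi (l : ℝ) (b : ℕ → ℝ) (j : ℕ) : ℝ := if j = 0 then 1 else -(l * b j)

lemma psi_zero (l : ℝ) (b : ℕ → ℝ) : psi l b 0 = 1 := by simp [psi]

lemma psi_succ (l : ℝ) (b : ℕ → ℝ) (j : ℕ) : psi l b (j + 1) = -(l * b (j + 1)) := by simp [psi]

lemma sum_z_mul_psi (l : ℝ) (b : ℕ → ℝ) (n : ℕ) :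
    ∑ p ∈ antidiagonal n, z l b p.1 * psi l b p.2 = if n = 0 then 1 else 0 := by
  have h := PowerSeries.mul_inv_cancel (PowerSeries.mk (psi l b))
    (by rw [← PowerSeries.coeff_zero_eq_constantCoeff_apply, PowerSeries.coeff_mk, psi_zero]
        exact one_ne_zero)
  have h' := congrArg (PowerSeries.coeff n) h
  rw [mul_comm, PowerSeries.coeff_mul, PowerSeries.coeff_one] at h'
  simp only [PowerSeries.coeff_mk] at h'
  exact h'

lemma z_zero (l : ℝ) (b : ℕ → ℝ) : z l b 0 = 1 := by
  have := sum_z_mul_psi l b 0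
  simpa [psi_zero] using this

/-- The renewal equation, read off from the coefficient of `t^(n+1)` in `(1/ψ) ψ = 1`. -/
lemma z_succ (l : ℝ) (b : ℕ → ℝ) (n : ℕ) :
    z l b (n + 1) = l * ∑ p ∈ antidiagonal n, b (p.1 + 1) * z l b p.2 := by
  have h := sum_z_mul_psi l b (n + 1)
  rw [← Finset.Nat.sum_antidiagonal_swap, Finset.Nat.sum_antidiagonal_succ] at h
  simp only [Prod.fst_swap, Prod.snd_swap, psi_zero, psi_succ, mul_one, Nat.add_eq_zero_iff,
    one_ne_zero, and_false, if_false] at h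
  rw [Finset.mul_sum, eq_neg_of_add_eq_zero_left h, ← Finset.sum_neg_distrib]
  exact Finset.sum_congr rfl fun p _ => by ring

section

variable {l : ℝ} {b : ℕ → ℝ}

lemma z_nonneg (hl : 0 ≤ l) (hb : ∀ j, 1 ≤ j → 0 ≤ b j) (n : ℕ) : 0 ≤ z l b n := by
  induction n using Nat.strong_induction_on with
  | _ n ih =>
    cases n with
    | zero => rw [z_zero]; exact zero_le_one
    | succ n =>
      rw [z_succ]
      refine mul_nonneg hl (Finset.sum_nonneg fun p hp => ?_)
      rw [Finset.HasAntidiagonal.mem_antidiagonal] at hp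
      exact mul_nonneg (hb _ (by omega)) (ih _ (by omega))

lemma le_z (hl : 0 ≤ l) (hb : ∀ j, 1 ≤ j → 0 ≤ b j) (n : ℕ) : l * b (n + 1) ≤ z l b (n + 1) := by
  rw [z_succ]
  refine mul_le_mul_of_nonneg_left ?_ hl
  have := Finset.single_le_sum (f := fun p : ℕ × ℕ => b (p.1 + 1) * z l b p.2)
    (fun p _ => mul_nonneg (hb _ (by omega)) (z_nonneg hl hb _))
    (Finset.HasAntidiagonal.mem_antidiagonal.2 (Nat.add_zero n) : ((n, 0) : ℕ × ℕ) ∈ antidiagonal n)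
  simpa [z_zero] using this

/-- By the renewal equation the partial sums satisfy `S_{N+1} ≤ 1 + l B S_N`, so they stay below the
fixed point `(1 - l B)⁻¹`. -/
lemma summable_z (hl : 0 ≤ l) (hb : ∀ j, 1 ≤ j → 0 ≤ b j) (hs : Summable fun j => b (j + 1))
    (h1 : l * ∑' j, b (j + 1) < 1) : Summable (z l b) := by
  set B := ∑' j, b (j + 1) with hB
  have hz := z_nonneg hl hb
  have hB0 : 0 ≤ B := tsum_nonneg fun j => hb _ (by omega)
  have hbound : ∀ N, ∑ n ∈ Finset.range N, z l b n ≤ (1 - l * B)⁻¹ := by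
    have hpos : 0 < 1 - l * B := by linarith
    intro N
    induction N with
    | zero => simpa using hpos.le
    | succ N ih =>
      rw [Finset.sum_range_succ', z_zero]
      have : ∑ n ∈ Finset.range N, z l b (n + 1) ≤ l * (B * (1 - l * B)⁻¹) := by
        simp_rw [z_succ]
        rw [← Finset.mul_sum]
        refine mul_le_mul_of_nonneg_left ?_ hl
        simp_rw [Finset.Nat.sum_antidiagonal_eq_sum_range_succ (fun i j => b (i + 1) * z l b j)]
        rw [Finset.sum_range_diag_flip N (fun i j => b (i + 1) * z l b j)]
        calc ∑ m ∈ Finset.range N, ∑ k ∈ Finset.range (N - m), b (m + 1) * z l b k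
            ≤ ∑ m ∈ Finset.range N, b (m + 1) * (1 - l * B)⁻¹ := by
              refine Finset.sum_le_sum fun m _ => ?_
              rw [← Finset.mul_sum]
              refine mul_le_mul_of_nonneg_left (le_trans ?_ ih) (hb _ (by omega))
              exact Finset.sum_le_sum_of_subset_of_nonneg
                (Finset.range_subset_range.2 (Nat.sub_le _ _)) fun i _ _ => hz i
          _ = (∑ m ∈ Finset.range N, b (m + 1)) * (1 - l * B)⁻¹ := by rw [Finset.sum_mul]
          _ ≤ B * (1 - l * B)⁻¹ := by
              refine mul_le_mul_of_nonneg_right ?_ (inv_nonneg.2 hpos.le)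
              exact hs.sum_le_tsum _ fun j _ => hb _ (by omega)
      have e : l * (B * (1 - l * B)⁻¹) + 1 = (1 - l * B)⁻¹ := by
        field_simp
        ring
      linarith
  exact summable_of_sum_range_le hz hbound

/-- Polynomial decay of `b` is inherited by `z`. -/
lemma z_le_rpow (hl : 0 ≤ l) (hb : ∀ j, 1 ≤ j → 0 ≤ b j) (hs : Summable fun j => b (j + 1))
    (h1 : l * ∑' j, b (j + 1) < 1) {K γ : ℝ} (hγ : 0 ≤ γ)
    (hK : ∀ j, b (j + 1) ≤ K * ((j : ℝ) + 1) ^ (-γ)) :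
    ∃ M, ∀ n : ℕ, z l b n ≤ M * ((n : ℝ) + 1) ^ (-γ) := by
  set B := ∑' j, b (j + 1) with hB
  have hz := z_nonneg hl hb
  have hzs := summable_z hl hb hs h1
  set Z := ∑' n, z l b n with hZ
  have hZ0 : 0 ≤ Z := tsum_nonneg hz
  have hK0 : 0 ≤ K := by
    have := (hb 1 le_rfl).trans (hK 0)
    simpa using this
  -- The convolution is split according to whether the index of `b` is at most `δ N`. If it is, then
  -- `p.2 + 1 ≥ (1 - δ) N`, and the induction hypothesis contributes the factor `l B (1 - δ)^(-γ)`,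
  -- which must stay below one.
  obtain ⟨δ, ⟨hδ0, hδ1⟩, hδ⟩ : ∃ δ : ℝ, (0 < δ ∧ δ < 1) ∧ l * B * (1 - δ) ^ (-γ) < 1 := by
    have hc : Tendsto (fun δ : ℝ => l * B * (1 - δ) ^ (-γ)) (𝓝[>] 0) (𝓝 (l * B * (1 - 0) ^ (-γ))) :=
      (((tendsto_const_nhds.sub tendsto_id).rpow_const (Or.inl (by norm_num))).const_mul _).mono_left
        nhdsWithin_le_nhds
    have h2 := hc.eventually_lt_const (u := 1) (by simpa using h1)
    have h3 : ∀ᶠ δ : ℝ in 𝓝[>] 0, δ < 1 :=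
      mem_nhdsWithin_of_mem_nhds (Iio_mem_nhds one_pos)
    obtain ⟨δ, ⟨h, h'⟩, h''⟩ := ((h2.and h3).and self_mem_nhdsWithin).exists
    exact ⟨δ, ⟨h'', h'⟩, h⟩
  set q := l * B * (1 - δ) ^ (-γ) with hq
  set K' := l * (K * δ ^ (-γ) * Z) with hK'
  have hK'0 : 0 ≤ K' := by positivity
  have hq1 : 0 < 1 - q := by linarith
  -- `M ≥ 1` starts the induction at `z(0) = 1`, and `M ≥ K' / (1 - q)` makes it close: `q M + K' ≤
  -- M`.
  refine ⟨max 1 (K' / (1 - q)), fun n => ?_⟩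
  set M := max 1 (K' / (1 - q)) with hM
  have hM0 : 0 ≤ M := zero_le_one.trans (le_max_left _ _)
  have hMq : q * M + K' ≤ M := by
    have : K' / (1 - q) ≤ M := le_max_right _ _
    rw [div_le_iff₀ hq1] at this
    linarith
  induction n using Nat.strong_induction_on with
  | _ n ih =>
    cases n with
    | zero => rw [z_zero]; simp [hM]
    | succ n =>
      set N : ℝ := ((n + 1 : ℕ) : ℝ) + 1 with hN
      have hN0 : 0 < N := by positivity
      -- Every term is bounded by the sum of the bounds for the two cases, so the antidiagonal need
      -- not be split.
      have key : ∀ p ∈ antidiagonal n, b (p.1 + 1) * z l b p.2 ≤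
          b (p.1 + 1) * (M * (1 - δ) ^ (-γ) * N ^ (-γ)) +
            K * δ ^ (-γ) * N ^ (-γ) * z l b p.2 := by
        intro p hp
        rw [Finset.HasAntidiagonal.mem_antidiagonal] at hp
        have hp' : (p.1 : ℝ) + p.2 = n := by exact_mod_cast hp
        have hb' := hb (p.1 + 1) (by omega)
        have hN' : N = p.1 + p.2 + 2 := by rw [hN]; push_cast; linarith
        by_cases hc : (p.1 : ℝ) + 1 ≤ δ * N
        · have : z l b p.2 ≤ M * (1 - δ) ^ (-γ) * N ^ (-γ) := by
            refine (ih p.2 (by omega)).trans ?_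
            rw [mul_assoc, ← Real.mul_rpow (by linarith) hN0.le]
            refine mul_le_mul_of_nonneg_left ?_ hM0
            exact Real.rpow_le_rpow_of_nonpos (mul_pos (by linarith) hN0) (by linarith)
              (by linarith)
          have h3 : 0 ≤ K * δ ^ (-γ) * N ^ (-γ) * z l b p.2 := mul_nonneg (by positivity) (hz _)
          have := mul_le_mul_of_nonneg_left this hb'
          linarith
        · have : b (p.1 + 1) ≤ K * δ ^ (-γ) * N ^ (-γ) := by
            refine (hK p.1).trans ?_
            rw [mul_assoc, ← Real.mul_rpow hδ0.le hN0.le]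
            refine mul_le_mul_of_nonneg_left ?_ hK0
            exact Real.rpow_le_rpow_of_nonpos (mul_pos hδ0 hN0) (by linarith) (by linarith)
          have h3 : 0 ≤ b (p.1 + 1) * (M * (1 - δ) ^ (-γ) * N ^ (-γ)) := by
            have : (0:ℝ) ≤ (1 - δ) ^ (-γ) := Real.rpow_nonneg (by linarith) _
            positivity
          have := mul_le_mul_of_nonneg_right this (hz p.2)
          linarith
      have hsb : ∑ p ∈ antidiagonal n, b (p.1 + 1) ≤ B := by
        rw [Finset.Nat.sum_antidiagonal_eq_sum_range_succ (fun i _ => b (i + 1))]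
        exact hs.sum_le_tsum _ fun j _ => hb _ (by omega)
      have hsz : ∑ p ∈ antidiagonal n, z l b p.2 ≤ Z := by
        rw [← Finset.Nat.sum_antidiagonal_swap]
        simp only [Prod.snd_swap]
        rw [Finset.Nat.sum_antidiagonal_eq_sum_range_succ (fun i _ => z l b i)]
        exact hzs.sum_le_tsum _ fun j _ => hz j
      have hδ2 : (0:ℝ) ≤ (1 - δ) ^ (-γ) := Real.rpow_nonneg (by linarith) _
      calc z l b (n + 1) = l * ∑ p ∈ antidiagonal n, b (p.1 + 1) * z l b p.2 := z_succ l b n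
        _ ≤ l * (B * (M * (1 - δ) ^ (-γ) * N ^ (-γ)) + K * δ ^ (-γ) * N ^ (-γ) * Z) := by
            refine mul_le_mul_of_nonneg_left ?_ hl
            refine (Finset.sum_le_sum key).trans ?_
            rw [Finset.sum_add_distrib, ← Finset.sum_mul, ← Finset.mul_sum]
            gcongr
        _ = (q * M + K') * N ^ (-γ) := by rw [hq, hK']; ring
        _ ≤ M * N ^ (-γ) := by gcongr

end

/-! ### Logarithmic ratios and power bounds. -/

lemma ofReal_rpow_log {n : ℕ} (hn : 2 ≤ n) (r : ℝ) :
    ENNReal.log (ENNReal.ofReal ((n : ℝ) ^ r)) = (r : EReal) * ((Real.log n : ℝ) : EReal) := by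
  have hn0 : (0 : ℝ) < n := by exact_mod_cast (by omega : 0 < n)
  rw [ENNReal.log_ofReal_of_pos (Real.rpow_pos_of_pos hn0 r), Real.log_rpow hn0, EReal.coe_mul]

lemma log_natCast_pos {n : ℕ} (hn : 2 ≤ n) : (0 : EReal) < ((Real.log n : ℝ) : EReal) := by
  exact_mod_cast Real.log_pos (by exact_mod_cast (by omega : 1 < n))

/-- `2 ≤ n` makes `log n` positive. If `u n ≤ 0`, the ratio is `-∞` and both sides hold. -/
lemma logRatio_le_iff {u : ℕ → ℝ} {n : ℕ} (hn : 2 ≤ n) (r : ℝ) :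
    logRatio u n ≤ r ↔ u n ≤ (n : ℝ) ^ r := by
  unfold logRatio
  rw [EReal.div_le_iff_le_mul (log_natCast_pos hn) (EReal.coe_ne_top _), mul_comm,
    ← ofReal_rpow_log hn, ENNReal.log_le_log_iff, ENNReal.ofReal_le_ofReal_iff (by positivity)]

lemma le_logRatio_iff {u : ℕ → ℝ} {n : ℕ} (hn : 2 ≤ n) (r : ℝ) :
    r ≤ logRatio u n ↔ (n : ℝ) ^ r ≤ u n := by
  have hn0 : (0 : ℝ) < n := by exact_mod_cast (by omega : 0 < n)
  unfold logRatio
  rw [EReal.le_div_iff_mul_le (log_natCast_pos hn) (EReal.coe_ne_top _),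
    ← ofReal_rpow_log hn, ENNReal.log_le_log_iff,
    ENNReal.ofReal_le_ofReal_iff' , or_iff_left]
  exact not_le.2 (Real.rpow_pos_of_pos hn0 r)

/-- A constant factor is absorbed by an arbitrarily small increase of the exponent. -/
lemma eventually_const_mul_rpow_le (K : ℝ) {r s : ℝ} (h : r < s) :
    ∀ᶠ n : ℕ in atTop, K * (n : ℝ) ^ r ≤ (n : ℝ) ^ s := by
  have ht := (tendsto_rpow_atTop (sub_pos.2 h)).comp tendsto_natCast_atTop_atTop
  filter_upwards [ht.eventually_ge_atTop K, eventually_gt_atTop 0] with n hn hn0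
  have hn0' : (0 : ℝ) < n := by exact_mod_cast hn0
  have : (n : ℝ) ^ s = (n : ℝ) ^ (s - r) * (n : ℝ) ^ r := by
    rw [← Real.rpow_add hn0']; ring_nf
  rw [this]
  exact mul_le_mul_of_nonneg_right hn (Real.rpow_nonneg hn0'.le _)

lemma limsup_logRatio_le_of_le_rpow {u : ℕ → ℝ} {K r : ℝ}
    (h : ∀ᶠ n : ℕ in atTop, u n ≤ K * (n : ℝ) ^ r) : limsup (logRatio u) atTop ≤ r := by
  refine EReal.le_of_forall_lt_iff_le.1 fun s hs => ?_
  refine limsup_le_of_le ⟨⊥, by simp⟩ ?_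
  filter_upwards [h, eventually_const_mul_rpow_le K (EReal.coe_lt_coe_iff.1 hs),
    eventually_ge_atTop 2] with n h1 h2 h3
  exact (logRatio_le_iff h3 s).2 (h1.trans h2)

lemma le_liminf_logRatio_of_rpow_le {u : ℕ → ℝ} {K r : ℝ} (hK : 0 ≤ K)
    (h : ∀ᶠ n : ℕ in atTop, (n : ℝ) ^ r ≤ K * u n) : r ≤ liminf (logRatio u) atTop := by
  refine EReal.ge_of_forall_gt_iff_ge.1 fun s hs => ?_
  refine le_liminf_of_le ⟨⊤, by simp⟩ ?_
  -- `K + 1` instead of `K` leaves a spare `n ^ s > 0`, which makes the final contradiction strict.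
  filter_upwards [h, eventually_const_mul_rpow_le (K + 1) (EReal.coe_lt_coe_iff.1 hs),
    eventually_ge_atTop 2] with n h1 h2 h3
  have hn0 : (0 : ℝ) < n := by exact_mod_cast (by omega : 0 < n)
  rw [le_logRatio_iff h3 s]
  by_contra hlt
  push Not at hlt
  have h4 : 0 < (n : ℝ) ^ s := Real.rpow_pos_of_pos hn0 s
  have h5 : K * u n ≤ K * (n : ℝ) ^ s := mul_le_mul_of_nonneg_left hlt.le hK
  linarith

lemma eventually_le_rpow_of_limsup_logRatio_lt {u : ℕ → ℝ} {r : ℝ}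
    (h : limsup (logRatio u) atTop < r) : ∀ᶠ n : ℕ in atTop, u n ≤ (n : ℝ) ^ r := by
  filter_upwards [eventually_lt_of_limsup_lt h, eventually_ge_atTop 2] with n h1 h2
  exact (logRatio_le_iff h2 r).1 h1.le

lemma eventually_rpow_le_of_lt_liminf_logRatio {u : ℕ → ℝ} {r : ℝ}
    (h : r < liminf (logRatio u) atTop) : ∀ᶠ n : ℕ in atTop, (n : ℝ) ^ r ≤ u n := by
  filter_upwards [eventually_lt_of_lt_liminf h, eventually_ge_atTop 2] with n h1 h2
  exact (le_logRatio_iff h2 r).1 h1.le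

lemma limsup_logRatio_mono {u v : ℕ → ℝ} {K : ℝ} (hK : 0 ≤ K)
    (h : ∀ᶠ n : ℕ in atTop, u n ≤ K * v n) :
    limsup (logRatio u) atTop ≤ limsup (logRatio v) atTop := by
  refine EReal.le_of_forall_lt_iff_le.1 fun s hs => ?_
  refine limsup_logRatio_le_of_le_rpow (K := K) ?_
  filter_upwards [h, eventually_le_rpow_of_limsup_logRatio_lt hs] with n h1 h2
  exact h1.trans (mul_le_mul_of_nonneg_left h2 hK)

lemma liminf_logRatio_mono {u v : ℕ → ℝ} {K : ℝ} (hK : 0 ≤ K)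
    (h : ∀ᶠ n : ℕ in atTop, u n ≤ K * v n) :
    liminf (logRatio u) atTop ≤ liminf (logRatio v) atTop := by
  refine EReal.ge_of_forall_gt_iff_ge.1 fun s hs => ?_
  refine le_liminf_logRatio_of_rpow_le hK ?_
  filter_upwards [h, eventually_rpow_le_of_lt_liminf_logRatio hs] with n h1 h2
  exact h2.trans h1

/-! ### Regrouping of double series, generated `σ`-algebras and L² tools. -/

section Series

/-- Regrouping by `i + j`. It serves both to invert `ψ` and to carry out one step of the expansion
of the volatility. -/
lemma summable_antidiagonal_mul {u v x : ℕ → ℝ}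
    (h : Summable fun p : ℕ × ℕ => u p.1 * (v p.2 * x (p.1 + p.2))) :
    (Summable fun n => (∑ p ∈ antidiagonal n, u p.1 * v p.2) * x n) ∧
      ∑' i, u i * ∑' j, v j * x (i + j) = ∑' n, (∑ p ∈ antidiagonal n, u p.1 * v p.2) * x n := by
  have h' := Finset.HasAntidiagonal.sigmaAntidiagonalEquivProd.summable_iff.2 h
  have e : ∀ n, (∑ p ∈ antidiagonal n, u p.1 * v p.2) * x n =
      ∑' p : antidiagonal n, u p.1.1 * (v p.1.2 * x (p.1.1 + p.1.2)) := by
    intro n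
    rw [tsum_fintype, Finset.sum_coe_sort (antidiagonal n)
      (fun p : ℕ × ℕ => u p.1 * (v p.2 * x (p.1 + p.2))), Finset.sum_mul]
    refine Finset.sum_congr rfl fun p hp => ?_
    rw [Finset.HasAntidiagonal.mem_antidiagonal.1 hp]
    ring
  refine ⟨?_, ?_⟩
  · simp_rw [e]
    exact h'.sigma
  · simp_rw [e, ← tsum_mul_left]
    rw [← h.tsum_prod, ← Finset.HasAntidiagonal.sigmaAntidiagonalEquivProd.tsum_eq]
    exact h'.tsum_sigma

end Series

section Generated

variable {S : Type*}

/-- The `σ`-algebra generated by the variables with index in `A`. -/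
@[reducible]
def sigmaOn (ζ : ℤ → S → ℝ) (A : Set ℤ) : MeasurableSpace S :=
  ⨆ j ∈ A, MeasurableSpace.comap (ζ j) inferInstance

lemma sigmaOn_mono {ζ : ℤ → S → ℝ} {A B : Set ℤ} (h : A ⊆ B) : sigmaOn ζ A ≤ sigmaOn ζ B :=
  biSup_mono h

lemma measurable_sigmaOn {ζ : ℤ → S → ℝ} {A : Set ℤ} {j : ℤ} (hj : j ∈ A) :
    Measurable[sigmaOn ζ A] (ζ j) :=
  measurable_iff_comap_le.2 (le_iSup₂_of_le j hj le_rfl)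

end Generated

section Measure

variable {S : Type*} [mS : MeasurableSpace S] {P : Measure S}

lemma aestronglyMeasurable_tsum {f : ℕ → S → ℝ} (hf : ∀ n, AEStronglyMeasurable (f n) P)
    (hs : ∀ᵐ s ∂P, Summable fun n => f n s) :
    AEStronglyMeasurable (fun s => ∑' n, f n s) P := by
  refine aestronglyMeasurable_of_tendsto_ae atTop
    (f := fun N s => ∑ n ∈ Finset.range N, f n s) (fun N => ?_) ?_
  · exact Finset.aestronglyMeasurable_fun_sum _ fun n _ => hf n
  · filter_upwards [hs] with s h using h.hasSum.tendsto_sum_nat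

lemma ae_summable_of_tsum_eLpNorm {ι : Type*} [Countable ι] {p : ℝ≥0∞} (hp : 1 ≤ p)
    {f : ι → S → ℝ} (hf : ∀ n, AEStronglyMeasurable (f n) P)
    (h : ∑' n, eLpNorm (f n) p P ≠ ∞) : ∀ᵐ s ∂P, Summable fun n => f n s := by
  filter_upwards [summable_norm_of_tsum_eLpNorm_ne_top hp hf h] with s hs using hs.of_norm

lemma eLpNorm_tsum_le {p : ℝ≥0∞} (hp : 1 ≤ p) {f : ℕ → S → ℝ}
    (hf : ∀ n, AEStronglyMeasurable (f n) P) :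
    eLpNorm (fun s => ∑' n, f n s) p P ≤ ∑' n, eLpNorm (f n) p P := by
  by_cases h : ∑' n, eLpNorm (f n) p P = ∞
  · rw [h]; exact le_top
  have hs := ae_summable_of_tsum_eLpNorm hp hf h
  refine (Lp.eLpNorm_lim_le_liminf_eLpNorm
    (f := fun N => ∑ n ∈ Finset.range N, f n)
    (fun N => Finset.aestronglyMeasurable_sum _ fun n _ => hf n) _ ?_).trans ?_
  · filter_upwards [hs] with s h
    simpa only [Finset.sum_apply] using h.hasSum.tendsto_sum_nat
  · refine liminf_le_of_le ⟨0, by simp⟩ fun c hc => ?_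
    obtain ⟨N, hN⟩ := hc.exists
    exact (hN.trans (eLpNorm_sum_le (fun i _ => hf i) hp)).trans (ENNReal.sum_le_tsum _)

/-- An almost sure limit of functions measurable for a sub-`σ`-algebra agrees almost surely with
a function measurable for it. -/
lemma exists_stronglyMeasurable_ae_eq_of_tendsto {m : MeasurableSpace S} {f : ℕ → S → ℝ} {h : S → ℝ}
    (hf : ∀ n, StronglyMeasurable[m] (f n))
    (hlim : ∀ᵐ s ∂P, Tendsto (fun n => f n s) atTop (𝓝 (h s))) :
    ∃ g, StronglyMeasurable[m] g ∧ h =ᵐ[P] g := by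
  refine ⟨fun s => limUnder atTop fun n => f n s, StronglyMeasurable.limUnder hf, ?_⟩
  filter_upwards [hlim] with s hs using hs.limUnder_eq.symm

lemma eLpNorm_mul_le_two {f g : S → ℝ} (hf : AEStronglyMeasurable f P)
    (hg : AEStronglyMeasurable g P) :
    eLpNorm (fun s => f s * g s) 1 P ≤ eLpNorm f 2 P * eLpNorm g 2 P :=
  eLpNorm_smul_le_mul_eLpNorm (𝕜 := ℝ) (E := ℝ) (p := 2) (q := 2) (r := 1) hg hf

lemma eLpNorm_two_eq {f : S → ℝ} (hf : MemLp f 2 P) :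
    eLpNorm f 2 P = ENNReal.ofReal (∫ s, f s ^ 2 ∂P) ^ (1 / 2 : ℝ) := by
  rw [hf.eLpNorm_eq_integral_rpow_norm (by norm_num) (by norm_num)]
  rw [ENNReal.ofReal_rpow_of_nonneg (integral_nonneg fun s => sq_nonneg _) (by norm_num)]
  simp

lemma integral_sum_sq_of_orthogonal {ι : Type*} (t : Finset ι) {f : ι → S → ℝ}
    (hf : ∀ i ∈ t, MemLp (f i) 2 P)
    (ho : ∀ i ∈ t, ∀ j ∈ t, i ≠ j → ∫ s, f i s * f j s ∂P = 0) :
    ∫ s, (∑ i ∈ t, f i s) ^ 2 ∂P = ∑ i ∈ t, ∫ s, f i s ^ 2 ∂P := by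
  simp_rw [sq (∑ i ∈ t, _), Finset.sum_mul_sum]
  have hi : ∀ i ∈ t, ∀ j ∈ t, Integrable (fun s => f i s * f j s) P :=
    fun i hi j hj => (hf i hi).integrable_mul (hf j hj)
  rw [integral_finsetSum _ fun i h => integrable_finsetSum _ fun j hj => hi i h j hj]
  refine Finset.sum_congr rfl fun i h => ?_
  rw [integral_finsetSum _ fun j hj => hi i h j hj,
    Finset.sum_eq_single_of_mem i h fun j hj hij => ho i h j hj hij.symm]
  simp_rw [sq]

lemma sigmaOn_le {ζ : ℤ → S → ℝ} (hζ : ∀ k, Measurable (ζ k)) (A : Set ℤ) : sigmaOn ζ A ≤ mS :=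
  iSup₂_le fun j _ => (hζ j).comap_le

lemma indepFun_of_measurable_sigmaOn {ζ : ℤ → S → ℝ} (hζ : ∀ k, Measurable (ζ k))
    (hi : iIndepFun ζ P) {A B : Set ℤ} (hAB : Disjoint A B) {f g : S → ℝ}
    (hf : Measurable[sigmaOn ζ A] f) (hg : Measurable[sigmaOn ζ B] g) : IndepFun f g P := by
  have h : Indep (sigmaOn ζ A) (sigmaOn ζ B) P :=
    indep_iSup_of_disjoint (fun j => (hζ j).comap_le) hi hAB
  exact indep_of_indep_of_le_left (indep_of_indep_of_le_right h hg.comap_le) hf.comap_le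

lemma integral_mul_sq_of_indepFun {f g : S → ℝ} (hf : Measurable f) (hg : Measurable g)
    (h : IndepFun f g P) :
    ∫ s, (f s * g s) ^ 2 ∂P = (∫ s, f s ^ 2 ∂P) * ∫ s, g s ^ 2 ∂P := by
  simp_rw [mul_pow]
  exact (h.comp (measurable_id.pow_const 2) (measurable_id.pow_const 2)).integral_mul_eq_mul_integral
    (hf.pow_const 2).aestronglyMeasurable (hg.pow_const 2).aestronglyMeasurable

lemma memLp_two_mul_of_indepFun {f g : S → ℝ} (hf : Measurable f) (hg : Measurable g)
    (h : IndepFun f g P) (hf2 : MemLp f 2 P) (hg2 : MemLp g 2 P) :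
    MemLp (fun s => f s * g s) 2 P := by
  have hm : AEStronglyMeasurable (fun s => f s * g s) P := (hf.mul hg).aestronglyMeasurable
  rw [memLp_two_iff_integrable_sq hm]
  simp_rw [mul_pow]
  exact (h.comp (measurable_id.pow_const 2) (measurable_id.pow_const 2)).integrable_mul
    hf2.integrable_sq hg2.integrable_sq

end Measure

/-! ### Homogeneous polynomials in independent centred variables. -/

/-- The weight of `n`-step descents from `k` to `k - d`: the sum over `j₁ + ⋯ + jₙ = d`, all
`jᵢ ≥ 1`, of the products of `c (jᵢ - 1) * ζ (k - j₁ - ⋯ - jᵢ)`. -/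
noncomputable def chaos {S : Type*} (c : ℕ → ℝ) (ζ : ℤ → S → ℝ) (k : ℤ) : ℕ → ℕ → S → ℝ
  | 0, d, _ => if d = 0 then 1 else 0
  | _ + 1, 0, _ => 0
  | n + 1, d + 1, s => (∑ p ∈ antidiagonal d, chaos c ζ k n p.1 s * c p.2) * ζ (k - ((d : ℤ) + 1)) s

section

variable {S : Type*} (c : ℕ → ℝ) (ζ : ℤ → S → ℝ) (k : ℤ)

lemma chaos_zero (d : ℕ) (s : S) : chaos c ζ k 0 d s = if d = 0 then 1 else 0 := by
  rw [chaos]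

lemma chaos_succ_zero (n : ℕ) (s : S) : chaos c ζ k (n + 1) 0 s = 0 := by
  rw [chaos]

lemma chaos_succ_succ (n d : ℕ) (s : S) : chaos c ζ k (n + 1) (d + 1) s =
    (∑ p ∈ antidiagonal d, chaos c ζ k n p.1 s * c p.2) * ζ (k - ((d : ℤ) + 1)) s := by
  rw [chaos]

lemma measurable_chaos (n d : ℕ) :
    Measurable[sigmaOn ζ (Set.Ico (k - d) k)] (chaos c ζ k n d) := by
  induction n generalizing d with
  | zero =>
    have : chaos c ζ k 0 d = fun _ => if d = 0 then 1 else 0 := funext fun s => chaos_zero c ζ k d s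
    rw [this]
    exact measurable_const
  | succ n ih =>
    cases d with
    | zero =>
      have : chaos c ζ k (n + 1) 0 = fun _ => 0 := funext fun s => chaos_succ_zero c ζ k n s
      rw [this]
      exact measurable_const
    | succ d =>
      have : chaos c ζ k (n + 1) (d + 1) = fun s => (∑ p ∈ antidiagonal d,
          chaos c ζ k n p.1 s * c p.2) * ζ (k - ((d : ℤ) + 1)) s :=
        funext fun s => chaos_succ_succ c ζ k n d s
      rw [this]
      refine Measurable.mul (Finset.measurable_fun_sum _ fun p hp => ?_)
        (measurable_sigmaOn (by simp))
      refine Measurable.mul_const ((ih p.1).mono (sigmaOn_mono fun x hx => ?_) le_rfl) _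
      rw [Finset.HasAntidiagonal.mem_antidiagonal] at hp
      simp only [Set.mem_Ico] at hx ⊢
      push_cast
      omega

/-- This sum is the coefficient of the oldest variable `ζ (k - d - 1)` in `chaos c ζ k (n + 1) (d +
1)`. It involves only later times, hence is independent of that variable when the `ζ` are. -/
lemma measurable_chaos_sum (n d : ℕ) : Measurable[sigmaOn ζ (Set.Ico (k - d) k)]
    fun s => ∑ p ∈ antidiagonal d, chaos c ζ k n p.1 s * c p.2 := by
  refine Finset.measurable_fun_sum _ fun p hp => ?_
  refine Measurable.mul_const ((measurable_chaos c ζ k n p.1).mono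
    (sigmaOn_mono fun x hx => ?_) le_rfl) _
  rw [Finset.HasAntidiagonal.mem_antidiagonal] at hp
  simp only [Set.mem_Ico] at hx ⊢
  omega

end

section

variable {S : Type*} [MeasurableSpace S] {P : Measure S}
  {c : ℕ → ℝ} {ζ : ℤ → S → ℝ}

lemma disjoint_singleton_Ico (k : ℤ) (d : ℕ) :
    Disjoint (Set.Ico (k - d) k) {k - ((d : ℤ) + 1)} := by
  rw [Set.disjoint_singleton_right, Set.mem_Ico]
  omega

lemma indepFun_chaos_sum (hζ : ∀ k, Measurable (ζ k)) (hi : iIndepFun ζ P) (k : ℤ) (n d : ℕ) :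
    IndepFun (fun s => ∑ p ∈ antidiagonal d, chaos c ζ k n p.1 s * c p.2)
      (ζ (k - ((d : ℤ) + 1))) P :=
  indepFun_of_measurable_sigmaOn hζ hi (disjoint_singleton_Ico k d)
    (measurable_chaos_sum c ζ k n d) (measurable_sigmaOn rfl)

lemma memLp_chaos [IsProbabilityMeasure P] (hζ : ∀ k, Measurable (ζ k)) (hi : iIndepFun ζ P) (h2 : ∀ k, MemLp (ζ k) 2 P)
    (k : ℤ) (n d : ℕ) : MemLp (chaos c ζ k n d) 2 P := by
  induction n generalizing d with
  | zero =>
    have : chaos c ζ k 0 d = fun _ => if d = 0 then 1 else 0 := funext fun s => chaos_zero c ζ k d s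
    rw [this]
    exact memLp_const _
  | succ n ih =>
    cases d with
    | zero =>
      have : chaos c ζ k (n + 1) 0 = fun _ => 0 := funext fun s => chaos_succ_zero c ζ k n s
      rw [this]
      exact memLp_const _
    | succ d =>
      have : chaos c ζ k (n + 1) (d + 1) = fun s => (∑ p ∈ antidiagonal d,
          chaos c ζ k n p.1 s * c p.2) * ζ (k - ((d : ℤ) + 1)) s :=
        funext fun s => chaos_succ_succ c ζ k n d s
      rw [this]
      exact memLp_two_mul_of_indepFun
        ((measurable_chaos_sum c ζ k n d).mono (sigmaOn_le hζ _) le_rfl) (hζ _)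
        (indepFun_chaos_sum hζ hi k n d)
        (memLp_finsetSum _ fun p _ => (ih p.1).mul_const _) (h2 _)

/-- For positive order, `ζ (k - j)` occurs exactly once in the product, is centred and is
independent of the rest. -/
lemma integral_chaos_mul_of_lt (hζ : ∀ k, Measurable (ζ k)) (hi : iIndepFun ζ P)
    (h0 : ∀ k, ∫ s, ζ k s ∂P = 0) (k : ℤ) (n : ℕ) {i j : ℕ} (hij : i < j) :
    ∫ s, chaos c ζ k n i s * chaos c ζ k n j s ∂P = 0 := by
  obtain ⟨d, rfl⟩ : ∃ d, j = d + 1 := ⟨j - 1, by omega⟩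
  cases n with
  | zero => simp [chaos_zero]
  | succ n =>
    have hm : Measurable[sigmaOn ζ (Set.Ico (k - d) k)] fun s => chaos c ζ k (n + 1) i s *
        ∑ p ∈ antidiagonal d, chaos c ζ k n p.1 s * c p.2 :=
      ((measurable_chaos c ζ k (n + 1) i).mono (sigmaOn_mono fun x hx => by
        simp only [Set.mem_Ico] at hx ⊢
        omega) le_rfl).mul (measurable_chaos_sum c ζ k n d)
    have hind := indepFun_of_measurable_sigmaOn hζ hi (disjoint_singleton_Ico k d) hm
      (measurable_sigmaOn (ζ := ζ) (A := {k - ((d : ℤ) + 1)}) rfl)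
    simp_rw [chaos_succ_succ, ← mul_assoc]
    rw [hind.integral_fun_mul_eq_mul_integral
      (hm.mono (sigmaOn_le hζ _) le_rfl).aestronglyMeasurable (hζ _).aestronglyMeasurable, h0,
      mul_zero]

lemma integral_chaos_mul_of_ne (hζ : ∀ k, Measurable (ζ k)) (hi : iIndepFun ζ P)
    (h0 : ∀ k, ∫ s, ζ k s ∂P = 0) (k : ℤ) (n : ℕ) {i j : ℕ} (hij : i ≠ j) :
    ∫ s, chaos c ζ k n i s * chaos c ζ k n j s ∂P = 0 := by
  rcases lt_or_gt_of_ne hij with h | h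
  · exact integral_chaos_mul_of_lt hζ hi h0 k n h
  · simp_rw [mul_comm (chaos c ζ k n i _)]
    exact integral_chaos_mul_of_lt hζ hi h0 k n h

/-- The power series `∑_{j ≥ 1} v c(j - 1)² t^j`. -/
noncomputable def chaosSeries (v : ℝ) (c : ℕ → ℝ) : PowerSeries ℝ≥0∞ :=
  PowerSeries.X * PowerSeries.mk fun j => ENNReal.ofReal (v * c j ^ 2)

/-- Independence splits off the oldest variable, contributing `v`, and orthogonality removes the
cross terms. Raising the order by one therefore multiplies the generating series of second moments
by `chaosSeries v c`. -/
lemma ofReal_integral_chaos_sq [IsProbabilityMeasure P] (hζ : ∀ k, Measurable (ζ k)) (hi : iIndepFun ζ P)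
    (h2 : ∀ k, MemLp (ζ k) 2 P) (h0 : ∀ k, ∫ s, ζ k s ∂P = 0) {v : ℝ}
    (hv : ∀ k, ∫ s, ζ k s ^ 2 ∂P = v) (k : ℤ) (n d : ℕ) :
    ENNReal.ofReal (∫ s, chaos c ζ k n d s ^ 2 ∂P) =
      PowerSeries.coeff d (chaosSeries v c ^ n) := by
  have hv0 : 0 ≤ v := by rw [← hv 0]; exact integral_nonneg fun s => sq_nonneg _
  induction n generalizing d with
  | zero =>
    simp_rw [chaos_zero, pow_zero, PowerSeries.coeff_one]
    split_ifs <;> simp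
  | succ n ih =>
    rw [pow_succ, chaosSeries, ← mul_assoc, mul_comm _ PowerSeries.X, mul_assoc, ← chaosSeries]
    cases d with
    | zero => simp [chaos_succ_zero]
    | succ d =>
      rw [PowerSeries.coeff_succ_X_mul, PowerSeries.coeff_mul]
      simp_rw [chaos_succ_succ]
      rw [integral_mul_sq_of_indepFun
        ((measurable_chaos_sum c ζ k n d).mono (sigmaOn_le hζ _) le_rfl) (hζ _)
        (indepFun_chaos_sum hζ hi k n d), hv, integral_sum_sq_of_orthogonal
          (f := fun (p : ℕ × ℕ) s => chaos c ζ k n p.1 s * c p.2) _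
          (fun p _ => (memLp_chaos hζ hi h2 k n p.1).mul_const _)]
      · rw [Finset.sum_mul, ENNReal.ofReal_sum_of_nonneg]
        · refine Finset.sum_congr rfl fun p _ => ?_
          rw [PowerSeries.coeff_mk, ← ih, ← ENNReal.ofReal_mul
            (integral_nonneg fun s => sq_nonneg _)]
          simp_rw [mul_pow]
          rw [integral_mul_const]
          ring_nf
        · exact fun p _ => mul_nonneg (integral_nonneg fun s => sq_nonneg _) hv0
      · intro p hp q hq hpq
        rw [Finset.HasAntidiagonal.mem_antidiagonal] at hp hq
        have hne : p.1 ≠ q.1 := fun h => hpq (Prod.ext h (by omega))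
        have e : ∀ s, chaos c ζ k n p.1 s * c p.2 * (chaos c ζ k n q.1 s * c q.2) =
            chaos c ζ k n p.1 s * chaos c ζ k n q.1 s * (c p.2 * c q.2) := fun s => by ring
        simp_rw [e]
        rw [integral_mul_const, integral_chaos_mul_of_ne hζ hi h0 k n hne, zero_mul]

lemma coeffSum_chaosSeries (v : ℝ) (c : ℕ → ℝ) :
    coeffSum (chaosSeries v c) = ∑' j, ENNReal.ofReal (v * c j ^ 2) := by
  unfold coeffSum chaosSeries
  rw [tsum_eq_zero_add' ENNReal.summable]
  simp [PowerSeries.coeff_succ_X_mul]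

lemma sqrtSum_chaosSeries (v : ℝ) (c : ℕ → ℝ) :
    sqrtSum (chaosSeries v c) = ∑' j, ENNReal.ofReal (v * c j ^ 2) ^ (1 / 2 : ℝ) := by
  unfold sqrtSum chaosSeries
  rw [tsum_eq_zero_add' ENNReal.summable]
  simp [PowerSeries.coeff_succ_X_mul]

lemma tsum_eLpNorm_chaos [IsProbabilityMeasure P] (hζ : ∀ k, Measurable (ζ k)) (hi : iIndepFun ζ P)
    (h2 : ∀ k, MemLp (ζ k) 2 P) (h0 : ∀ k, ∫ s, ζ k s ∂P = 0) {v : ℝ}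
    (hv : ∀ k, ∫ s, ζ k s ^ 2 ∂P = v) (k : ℤ) (n : ℕ) :
    ∑' d, eLpNorm (chaos c ζ k n d) 2 P = sqrtSum (chaosSeries v c ^ n) := by
  refine tsum_congr fun d => ?_
  rw [eLpNorm_two_eq (memLp_chaos hζ hi h2 k n d), ofReal_integral_chaos_sq hζ hi h2 h0 hv]

end

/-! ### Causality for a linear recursion with centred multiplicative noise. -/

section

variable {S : Type*} [MeasurableSpace S] {P : Measure S} [IsProbabilityMeasure P]
  {c : ℕ → ℝ} {ζ τ : ℤ → S → ℝ} {α : ℝ} {C : ℝ≥0∞}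

/-- One step of the expansion of a solution of `τ(k) = α + ∑ c(j) ζ(k-j-1) τ(k-j-1)`. -/
lemma chaos_remainder_step (hζ : ∀ k, Measurable (ζ k)) (hi : iIndepFun ζ P)
    (h2 : ∀ k, MemLp (ζ k) 2 P) (hτ : ∀ k, AEStronglyMeasurable (τ k) P)
    (hC : C ≠ ∞) (he : ∀ k, eLpNorm (fun s => ζ k s * τ k s) 2 P ≤ C)
    (hc : ∑' j, ‖c j‖ₑ ≠ ∞)
    (heq : ∀ k, ∀ᵐ s ∂P, τ k s =
      α + ∑' j : ℕ, c j * (ζ (k - ((j : ℤ) + 1)) s * τ (k - ((j : ℤ) + 1)) s))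
    (k : ℤ) (n : ℕ) (hfin : ∑' d, eLpNorm (chaos c ζ k n d) 2 P ≠ ∞) :
    (∀ᵐ s ∂P, Summable fun d => chaos c ζ k n d s) ∧
    ∀ᵐ s ∂P, ∑' d : ℕ, chaos c ζ k n d s * τ (k - d) s =
      α * ∑' d, chaos c ζ k n d s + ∑' d : ℕ, chaos c ζ k (n + 1) d s * τ (k - d) s := by
  have hm : ∀ d, AEStronglyMeasurable (chaos c ζ k n d) P :=
    fun d => (memLp_chaos hζ hi h2 k n d).aestronglyMeasurable
  have hem : ∀ k, AEStronglyMeasurable (fun s => ζ k s * τ k s) P :=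
    fun k => (hζ k).aestronglyMeasurable.mul (hτ k)
  have s1 : ∀ᵐ s ∂P, Summable fun d => chaos c ζ k n d s :=
    ae_summable_of_tsum_eLpNorm one_le_two hm hfin
  -- Nothing is known about the joint law of the polynomials and `τ`, so only Cauchy-Schwarz is
  -- used, with the uniform L² bound `C`.
  have s2 : ∀ᵐ s ∂P, Summable fun p : ℕ × ℕ => chaos c ζ k n p.1 s *
      (c p.2 * (ζ (k - (((p.1 + p.2 : ℕ) : ℤ) + 1)) s * τ (k - (((p.1 + p.2 : ℕ) : ℤ) + 1)) s)) := by
    refine ae_summable_of_tsum_eLpNorm le_rfl (fun p => (hm p.1).mul ((hem _).const_mul _)) ?_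
    refine ne_top_of_le_ne_top ?_ (ENNReal.tsum_le_tsum (g := fun p : ℕ × ℕ =>
      eLpNorm (chaos c ζ k n p.1) 2 P * (‖c p.2‖ₑ * C)) fun p => ?_)
    · rw [ENNReal.tsum_prod']
      simp_rw [ENNReal.tsum_mul_left, ENNReal.tsum_mul_right]
      exact ENNReal.mul_ne_top hfin (ENNReal.mul_ne_top hc hC)
    · refine (eLpNorm_mul_le_two (hm p.1) ((hem _).const_mul _)).trans ?_
      gcongr
      refine (eLpNorm_const_smul_le (c := c p.2)
        (f := fun s => ζ (k - (((p.1 + p.2 : ℕ) : ℤ) + 1)) s *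
          τ (k - (((p.1 + p.2 : ℕ) : ℤ) + 1)) s)).trans ?_
      gcongr
      exact he _
  refine ⟨s1, ?_⟩
  filter_upwards [s1, s2, ae_all_iff.2 fun d : ℕ => heq (k - d)] with s h1 h2' h3
  obtain ⟨h4, h5⟩ := summable_antidiagonal_mul
    (u := fun d => chaos c ζ k n d s) (v := c)
    (x := fun m => ζ (k - ((m : ℤ) + 1)) s * τ (k - ((m : ℤ) + 1)) s) h2'
  have e1 : ∀ d : ℕ, chaos c ζ k n d s * τ (k - d) s = α * chaos c ζ k n d s +
      chaos c ζ k n d s * ∑' j : ℕ, c j * (ζ (k - (((d + j : ℕ) : ℤ) + 1)) s *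
        τ (k - (((d + j : ℕ) : ℤ) + 1)) s) := by
    intro d
    rw [h3 d, mul_add, mul_comm _ α]
    congr 2
    refine tsum_congr fun j => ?_
    rw [show k - (d : ℤ) - ((j : ℤ) + 1) = k - (((d + j : ℕ) : ℤ) + 1) by push_cast; ring]
  have e2 : ∀ m : ℕ, (∑ p ∈ antidiagonal m, chaos c ζ k n p.1 s * c p.2) *
      (ζ (k - ((m : ℤ) + 1)) s * τ (k - ((m : ℤ) + 1)) s) =
      chaos c ζ k (n + 1) (m + 1) s * τ (k - ((m + 1 : ℕ) : ℤ)) s := by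
    intro m
    rw [chaos_succ_succ, mul_assoc]
    push_cast
    rfl
  simp_rw [e1]
  simp_rw [e2] at h4 h5
  have h6 := h2'.prod
  simp_rw [tsum_mul_left] at h6
  -- A polynomial of order `n + 1` vanishes at `d = 0`, so the regrouped term of index `m` is the
  -- one for `d = m + 1`.
  rw [Summable.tsum_add (h1.mul_left α) h6, h5, tsum_mul_left,
    tsum_eq_zero_add' (f := fun d : ℕ => chaos c ζ k (n + 1) d s * τ (k - d) s) h4,
    chaos_succ_zero, zero_mul, zero_add]

/-- A square integrable solution of `τ(k) = α + ∑ c(j) ζ(k-j-1) τ(k-j-1)` with centred independent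
`ζ` is a function of the past when `Var(ζ) ∑ c(j)² < 1`. -/
theorem exists_stronglyMeasurable_past (hζ : ∀ k, Measurable (ζ k)) (hi : iIndepFun ζ P)
    (h2 : ∀ k, MemLp (ζ k) 2 P) (h0 : ∀ k, ∫ s, ζ k s ∂P = 0) {v : ℝ}
    (hv : ∀ k, ∫ s, ζ k s ^ 2 ∂P = v) (hτ : ∀ k, AEStronglyMeasurable (τ k) P)
    (hC : C ≠ ∞) (hτC : ∀ k, eLpNorm (τ k) 2 P ≤ C)
    (he : ∀ k, eLpNorm (fun s => ζ k s * τ k s) 2 P ≤ C)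
    (hc0 : ∀ j, 0 ≤ c j) (hc : Summable c) (hc2 : Summable fun j => c j ^ 2)
    (hcv : v * ∑' j, c j ^ 2 < 1)
    (heq : ∀ k, ∀ᵐ s ∂P, τ k s =
      α + ∑' j : ℕ, c j * (ζ (k - ((j : ℤ) + 1)) s * τ (k - ((j : ℤ) + 1)) s)) (k : ℤ) :
    ∃ g, StronglyMeasurable[sigmaOn ζ (Set.Iio k)] g ∧ τ k =ᵐ[P] g := by
  have hv0 : 0 ≤ v := by rw [← hv 0]; exact integral_nonneg fun s => sq_nonneg _
  have hcn : ∑' j, ‖c j‖ₑ ≠ ∞ := by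
    simp_rw [Real.enorm_of_nonneg (hc0 _)]
    exact hc.tsum_ofReal_ne_top
  have hsum : coeffSum (chaosSeries v c) < 1 := by
    rw [coeffSum_chaosSeries, ← ENNReal.ofReal_tsum_of_nonneg
      (fun j => mul_nonneg hv0 (sq_nonneg _)) (hc2.mul_left v), tsum_mul_left]
    exact ENNReal.ofReal_lt_one.2 hcv
  have hsqrt : sqrtSum (chaosSeries v c) ≠ ∞ := by
    have e : ∀ j, ENNReal.ofReal (v * c j ^ 2) ^ (1 / 2 : ℝ) = ENNReal.ofReal (√v * c j) := by
      intro j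
      rw [ENNReal.ofReal_rpow_of_nonneg (mul_nonneg hv0 (sq_nonneg _)) (by norm_num),
        ← Real.sqrt_eq_rpow, Real.sqrt_mul hv0, Real.sqrt_sq (hc0 j)]
    rw [sqrtSum_chaosSeries]
    simp_rw [e]
    exact (hc.mul_left _).tsum_ofReal_ne_top
  have hfin : ∀ n, ∑' d, eLpNorm (chaos c ζ k n d) 2 P ≠ ∞ := by
    intro n
    rw [tsum_eLpNorm_chaos hζ hi h2 h0 hv]
    exact ne_top_of_le_ne_top (ENNReal.pow_ne_top hsqrt) (sqrtSum_pow_le _ _)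
  have hmeas : ∀ n d, StronglyMeasurable[sigmaOn ζ (Set.Iio k)] (chaos c ζ k n d) := fun n d =>
    ((measurable_chaos c ζ k n d).mono (sigmaOn_mono fun x hx => hx.2) le_rfl).stronglyMeasurable
  -- `p` collects the terms depending only on past variables. For `n = 0` the remainder is `τ k`
  -- itself.
  have hexp : ∀ n, ∃ p, StronglyMeasurable[sigmaOn ζ (Set.Iio k)] p ∧
      ∀ᵐ s ∂P, τ k s = p s + ∑' d : ℕ, chaos c ζ k n d s * τ (k - d) s := by
    intro n
    induction n with
    | zero =>
      refine ⟨fun _ => 0, stronglyMeasurable_const, Eventually.of_forall fun s => ?_⟩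
      rw [tsum_eq_single 0 (fun d hd => by simp [chaos_zero, hd])]
      simp [chaos_zero]
    | succ n ih =>
      obtain ⟨p, hp, hpe⟩ := ih
      obtain ⟨hs, hstep⟩ := chaos_remainder_step hζ hi h2 hτ hC he hcn heq k n (hfin n)
      obtain ⟨g, hg, hge⟩ := exists_stronglyMeasurable_ae_eq_of_tendsto
        (f := fun N s => ∑ d ∈ Finset.range N, chaos c ζ k n d s)
        (fun N => Finset.stronglyMeasurable_fun_sum _ fun d _ => hmeas n d)
        (hs.mono fun s h => h.hasSum.tendsto_sum_nat)
      refine ⟨fun s => p s + α * g s, hp.add (hg.const_mul α), ?_⟩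
      filter_upwards [hpe, hstep, hge] with s h1 h2 h3
      rw [h1, h2, h3]
      ring
  choose p hp hpe using hexp
  have hle := sigmaOn_le hζ (Set.Iio k)
  have hpm : ∀ n, AEStronglyMeasurable (p n) P := fun n => ((hp n).mono hle).aestronglyMeasurable
  have hlim : Tendsto (fun n => eLpNorm (p n - τ k) 1 P) atTop (𝓝 0) := by
    have hb : ∀ n, eLpNorm (p n - τ k) 1 P ≤ sqrtSum (chaosSeries v c ^ n) * C := by
      intro n
      rw [eLpNorm_sub_comm]
      have : τ k - p n =ᵐ[P] fun s => ∑' d : ℕ, chaos c ζ k n d s * τ (k - d) s := by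
        filter_upwards [hpe n] with s hs
        rw [Pi.sub_apply, hs, add_sub_cancel_left]
      have hm : ∀ d, AEStronglyMeasurable (chaos c ζ k n d) P :=
        fun d => ((hmeas n d).mono hle).aestronglyMeasurable
      rw [eLpNorm_congr_ae this, ← tsum_eLpNorm_chaos hζ hi h2 h0 hv k n, ← ENNReal.tsum_mul_right]
      refine (eLpNorm_tsum_le le_rfl fun d => (hm d).mul (hτ _)).trans
        (ENNReal.tsum_le_tsum fun d => (eLpNorm_mul_le_two (hm d) (hτ _)).trans ?_)
      gcongr
      exact hτC _
    have h3 := ENNReal.Tendsto.mul_const (b := C) (tendsto_sqrtSum_pow hsum hsqrt) (Or.inr hC)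
    rw [zero_mul] at h3
    exact tendsto_of_tendsto_of_tendsto_of_le_of_le tendsto_const_nhds h3 (fun _ => zero_le) hb
  -- L¹ convergence gives almost sure convergence along a subsequence, whose limit has a version
  -- measurable with respect to the past.
  obtain ⟨ns, -, hns⟩ :=
    (tendstoInMeasure_of_tendsto_eLpNorm one_ne_zero hpm (hτ k) hlim).exists_seq_tendsto_ae
  exact exists_stronglyMeasurable_ae_eq_of_tendsto (fun i => hp (ns i)) hns

end

/-! ### The linear equations of a solution and their inversion. -/

section

variable {S : Type*} [MeasurableSpace S] {P : Measure S}
  {a : ℝ} {b : ℕ → ℝ} {ξ X : ℤ → S → ℝ} {ρ : ℤ → ℝ}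

lemma IsWeaklyStationary.integral_sq_eq [IsProbabilityMeasure P] (h : IsWeaklyStationary P X ρ) (k : ℤ) :
    ∫ s, X k s ^ 2 ∂P = ρ 0 + (∫ s, X 0 s ∂P) ^ 2 := by
  have h1 := h.cov_eq k 0
  rw [add_zero, covariance_self (h.memLp k).aestronglyMeasurable.aemeasurable,
    variance_eq_sub (h.memLp k), h.mean_const k] at h1
  simp only [Pi.pow_apply] at h1
  linarith

lemma IsWeaklyStationary.eLpNorm_eq [IsProbabilityMeasure P] (h : IsWeaklyStationary P X ρ) (k : ℤ) :
    eLpNorm (X k) 2 P = eLpNorm (X 0) 2 P := by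
  rw [eLpNorm_two_eq (h.memLp k), eLpNorm_two_eq (h.memLp 0), h.integral_sq_eq k,
    h.integral_sq_eq 0]

lemma eLpNorm_const_mul_le {f : S → ℝ} (c : ℝ) {p : ℝ≥0∞} :
    eLpNorm (fun s => c * f s) p P ≤ ‖c‖ₑ * eLpNorm f p P :=
  eLpNorm_const_smul_le (c := c) (f := f)

lemma IsSolution.aestronglyMeasurable_volatility (hX : IsSolution P a b ξ X)
    (hρ : IsWeaklyStationary P X ρ) (k : ℤ) : AEStronglyMeasurable (volatility a b X k) P :=
  aestronglyMeasurable_const.add (aestronglyMeasurable_tsum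
    (fun _ => (hρ.memLp _).aestronglyMeasurable.const_mul _) (hX.summable k))

lemma exists_eLpNorm_volatility_le [IsProbabilityMeasure P]
    (hρ : IsWeaklyStationary P X ρ) (hX : IsSolution P a b ξ X)
    (hb : Summable fun j : ℕ => b (j + 1)) :
    ∃ C : ℝ≥0∞, C ≠ ∞ ∧ ∀ k, eLpNorm (volatility a b X k) 2 P ≤ C := by
  refine ⟨ENNReal.ofReal a + (∑' j : ℕ, ENNReal.ofReal (b (j + 1))) * eLpNorm (X 0) 2 P,
    ENNReal.add_ne_top.2 ⟨ENNReal.ofReal_ne_top,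
      ENNReal.mul_ne_top hb.tsum_ofReal_ne_top (hρ.memLp 0).eLpNorm_ne_top⟩, fun k => ?_⟩
  have hm : ∀ j : ℕ, AEStronglyMeasurable (fun s => b (j + 1) * X (k - ((j : ℤ) + 1)) s) P :=
    fun j => (hρ.memLp _).aestronglyMeasurable.const_mul _
  refine (eLpNorm_add_le (f := fun _ => a) aestronglyMeasurable_const
    (aestronglyMeasurable_tsum hm (hX.summable k)) one_le_two).trans ?_
  gcongr
  · rw [eLpNorm_const _ (by norm_num) (IsProbabilityMeasure.ne_zero P)]
    simp [Real.enorm_of_nonneg hX.a_nonneg]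
  · refine (eLpNorm_tsum_le one_le_two hm).trans ?_
    rw [← ENNReal.tsum_mul_right]
    refine ENNReal.tsum_le_tsum fun j => (eLpNorm_const_mul_le _).trans ?_
    rw [hρ.eLpNorm_eq, Real.enorm_of_nonneg (hX.b_nonneg _ (by omega))]

/-- The centred shocks. -/
noncomputable def centred (P : Measure S) (ξ : ℤ → S → ℝ) (k : ℤ) (s : S) : ℝ := ξ k s - lam P ξ

/-- The innovations `(ξ(k) - λ₁) ς(k)`. -/
noncomputable def innovation (P : Measure S) (a : ℝ) (b : ℕ → ℝ) (ξ X : ℤ → S → ℝ) (k : ℤ) (s : S) :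
    ℝ := centred P ξ k s * volatility a b X k s

lemma IsSolution.ae_eq_add_innovation (hX : IsSolution P a b ξ X) (k : ℤ) :
    ∀ᵐ s ∂P, X k s = lam P ξ * volatility a b X k s + innovation P a b ξ X k s := by
  filter_upwards [hX.equation k] with s hs
  rw [hs, innovation, centred]
  ring

lemma IsSolution.lam_nonneg (hX : IsSolution P a b ξ X) : 0 ≤ lam P ξ :=
  integral_nonneg_of_ae (hX.shock_nonneg 0)

/-- Inversion of the linear equations satisfied by a solution. -/
lemma IsSolution.ae_eq_tsum_innovation [IsProbabilityMeasure P]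
    (hX : IsSolution P a b ξ X) (hρ : IsWeaklyStationary P X ρ)
    (hS1 : CondS1 P b ξ) (k : ℤ) :
    ∀ᵐ s ∂P, (Summable fun j : ℕ => z (lam P ξ) b j * innovation P a b ξ X (k - j) s) ∧
      X k s = lam P ξ * (a * ∑' j, z (lam P ξ) b j) +
        ∑' j : ℕ, z (lam P ξ) b j * innovation P a b ξ X (k - j) s := by
  set l := lam P ξ with hl
  have hl0 : 0 ≤ l := hX.lam_nonneg
  have hz0 := z_nonneg hl0 hX.b_nonneg
  have hzs := summable_z hl0 hX.b_nonneg hS1.1 hS1.2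
  have hXm : ∀ k, AEStronglyMeasurable (X k) P := fun k => (hρ.memLp k).aestronglyMeasurable
  have hpsi : Summable fun j => ‖psi l b j‖ := by
    rw [← summable_nat_add_iff 1]
    simp_rw [psi_succ, norm_neg, norm_mul]
    exact (hS1.1.norm).mul_left _
  have s2 : ∀ᵐ s ∂P, Summable fun p : ℕ × ℕ =>
      z l b p.1 * (psi l b p.2 * X (k - ((p.1 + p.2 : ℕ) : ℤ)) s) := by
    refine ae_summable_of_tsum_eLpNorm one_le_two
      (fun p => ((hXm _).const_mul _).const_mul _) ?_
    refine ne_top_of_le_ne_top ?_ (ENNReal.tsum_le_tsum (g := fun p : ℕ × ℕ =>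
      ‖z l b p.1‖ₑ * (‖psi l b p.2‖ₑ * eLpNorm (X 0) 2 P)) fun p => ?_)
    · rw [ENNReal.tsum_prod']
      simp_rw [ENNReal.tsum_mul_left, ENNReal.tsum_mul_right]
      exact ENNReal.mul_ne_top (tsum_enorm_ne_top_iff_summable_norm.2 hzs.norm)
        (ENNReal.mul_ne_top (tsum_enorm_ne_top_iff_summable_norm.2 hpsi)
          (hρ.memLp 0).eLpNorm_ne_top)
    · refine (eLpNorm_const_mul_le _).trans ?_
      gcongr
      refine (eLpNorm_const_mul_le _).trans ?_
      rw [hρ.eLpNorm_eq]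
  filter_upwards [s2, ae_all_iff.2 hX.summable, ae_all_iff.2 hX.ae_eq_add_innovation] with s h2 h3 h4
  -- The ARCH equations as a convolution: `ψ` applied to `X` is a constant plus the innovation.
  have h5 : ∀ m : ℤ, ∑' j : ℕ, psi l b j * X (m - j) s = l * a + innovation P a b ξ X m s := by
    intro m
    have e : ∀ j : ℕ, psi l b (j + 1) * X (m - ((j + 1 : ℕ) : ℤ)) s =
        -l * (b (j + 1) * X (m - ((j : ℤ) + 1)) s) := by
      intro j
      rw [psi_succ]
      push_cast
      ring
    have hsum : Summable fun j : ℕ => psi l b (j + 1) * X (m - ((j + 1 : ℕ) : ℤ)) s := by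
      simp_rw [e]
      exact (h3 m).mul_left _
    rw [tsum_eq_zero_add' hsum]
    simp_rw [e]
    rw [tsum_mul_left, psi_zero, one_mul, Nat.cast_zero, sub_zero, h4 m, volatility]
    ring
  obtain ⟨-, h7⟩ := summable_antidiagonal_mul (u := z l b) (v := psi l b)
    (x := fun n => X (k - (n : ℤ)) s) h2
  have h8 : ∀ i : ℕ, z l b i * ∑' j : ℕ, psi l b j * X (k - ((i + j : ℕ) : ℤ)) s =
      z l b i * (l * a) + z l b i * innovation P a b ξ X (k - i) s := by
    intro i
    rw [← mul_add, ← h5]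
    congr 1
    refine tsum_congr fun j => ?_
    rw [show k - ((i + j : ℕ) : ℤ) = k - (i : ℤ) - j by push_cast; ring]
  have h9 : Summable fun i : ℕ =>
      z l b i * ∑' j : ℕ, psi l b j * X (k - ((i + j : ℕ) : ℤ)) s := by
    simpa only [tsum_mul_left] using h2.prod
  simp_rw [h8] at h9
  have h10 : Summable fun j : ℕ => z l b j * innovation P a b ξ X (k - j) s := by
    have := h9.sub (hzs.mul_right (l * a))
    simpa only [add_sub_cancel_left] using this
  refine ⟨h10, ?_⟩
  simp_rw [h8, sum_z_mul_psi] at h7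
  have h11 : ∑' n : ℕ, (if n = 0 then (1 : ℝ) else 0) * X (k - n) s = X k s := by
    rw [tsum_eq_single 0 fun n hn => by rw [if_neg hn, zero_mul]]
    simp
  rw [Summable.tsum_add (hzs.mul_right (l * a)) h10, tsum_mul_right, h11] at h7
  rw [← h7]
  ring

/-- The term `j = 0` of the inverted equation is the innovation at time `k`. It cancels against
`X(k) = λ₁ ς(k) + η(k)`, and division by `λ₁` leaves a recursion for `ς` driven by centred shocks.
The original recursion has uncentred shocks, for which orthogonality fails. -/
lemma IsSolution.ae_volatility_eq_tsum [IsProbabilityMeasure P]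
    (hX : IsSolution P a b ξ X) (hρ : IsWeaklyStationary P X ρ)
    (hl : 0 < lam P ξ) (hS1 : CondS1 P b ξ) (k : ℤ) :
    ∀ᵐ s ∂P, volatility a b X k s = a * ∑' j, z (lam P ξ) b j +
      ∑' j : ℕ, z (lam P ξ) b (j + 1) / lam P ξ * (centred P ξ (k - ((j : ℤ) + 1)) s *
        volatility a b X (k - ((j : ℤ) + 1)) s) := by
  filter_upwards [hX.ae_eq_tsum_innovation hρ hS1 k, hX.ae_eq_add_innovation k] with s h1 h2
  obtain ⟨h3, h4⟩ := h1
  rw [h3.tsum_eq_zero_add, z_zero, one_mul, Nat.cast_zero, sub_zero, h2] at h4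
  have h5 : lam P ξ * volatility a b X k s = lam P ξ * (a * ∑' j, z (lam P ξ) b j) +
      ∑' j : ℕ, z (lam P ξ) b (j + 1) * innovation P a b ξ X (k - ((j : ℤ) + 1)) s := by
    push_cast at h4
    linarith
  have h6 : ∀ j : ℕ, z (lam P ξ) b (j + 1) / lam P ξ * (centred P ξ (k - ((j : ℤ) + 1)) s *
      volatility a b X (k - ((j : ℤ) + 1)) s) =
      (lam P ξ)⁻¹ * (z (lam P ξ) b (j + 1) * innovation P a b ξ X (k - ((j : ℤ) + 1)) s) := by
    intro j
    rw [innovation]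
    ring
  simp_rw [h6]
  rw [tsum_mul_left]
  field_simp
  linarith

end

/-! ### Causality of the volatility and orthogonality of the innovations. -/

section

variable {S : Type*} [MeasurableSpace S] {P : Measure S}
  {a : ℝ} {b : ℕ → ℝ} {ξ X : ℤ → S → ℝ} {ρ : ℤ → ℝ}

lemma IsSolution.measurable_centred (hX : IsSolution P a b ξ X) (k : ℤ) :
    Measurable (centred P ξ k) :=
  (hX.shock_measurable k).sub_const _

lemma IsSolution.iIndepFun_centred (hX : IsSolution P a b ξ X) : iIndepFun (centred P ξ) P :=
  hX.shock_indep.comp (fun _ x => x - lam P ξ) fun _ => measurable_id.sub_const _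

lemma IsSolution.memLp_centred [IsProbabilityMeasure P]
    (hX : IsSolution P a b ξ X) (h2 : MemLp (ξ 0) 2 P) (k : ℤ) :
    MemLp (centred P ξ k) 2 P :=
  ((hX.shock_ident k).symm.memLp_snd h2).sub (memLp_const _)

lemma IsSolution.integral_shock (hX : IsSolution P a b ξ X) (k : ℤ) :
    ∫ s, ξ k s ∂P = lam P ξ := (hX.shock_ident k).integral_eq

lemma IsSolution.integral_centred [IsProbabilityMeasure P]
    (hX : IsSolution P a b ξ X) (h2 : MemLp (ξ 0) 2 P) (k : ℤ) :
    ∫ s, centred P ξ k s ∂P = 0 := by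
  unfold centred
  rw [integral_sub (((hX.shock_ident k).symm.memLp_snd h2).integrable one_le_two)
    (integrable_const _), hX.integral_shock]
  simp

lemma IsSolution.integral_centred_sq [IsProbabilityMeasure P]
    (hX : IsSolution P a b ξ X) (k : ℤ) :
    ∫ s, centred P ξ k s ^ 2 ∂P = sigma P ξ ^ 2 := by
  rw [sigma, Real.sq_sqrt (variance_nonneg _ _), ← (hX.shock_ident k).variance_eq,
    variance_eq_integral (hX.shock_measurable k).aemeasurable, hX.integral_shock]
  rfl

/-- (S2) squared is the contraction condition of `exists_stronglyMeasurable_past` for `c = z / λ₁`.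
-/
lemma CondS2.mul_tsum_lt_one (h : CondS2 P b ξ) (hl : 0 ≤ lam P ξ) :
    sigma P ξ ^ 2 * ∑' j : ℕ, (z (lam P ξ) b (j + 1) / lam P ξ) ^ 2 < 1 := by
  obtain ⟨-, h2⟩ := h
  have h0 : 0 ≤ ∑' j : ℕ, z (lam P ξ) b (j + 1) ^ 2 := tsum_nonneg fun j => sq_nonneg _
  simp_rw [div_pow]
  rw [tsum_div_const]
  have e : sigma P ξ ^ 2 * ((∑' j : ℕ, z (lam P ξ) b (j + 1) ^ 2) / lam P ξ ^ 2) =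
      (sigma P ξ / lam P ξ * √(∑' j : ℕ, z (lam P ξ) b (j + 1) ^ 2)) ^ 2 := by
    rw [mul_pow, Real.sq_sqrt h0]
    ring
  rw [e]
  exact pow_lt_one₀ (mul_nonneg (div_nonneg (Real.sqrt_nonneg _) hl) (Real.sqrt_nonneg _)) h2
    two_ne_zero

/-- Every weakly stationary solution is causal: the volatility is a function of past shocks. -/
theorem exists_volatility_ae_eq [IsProbabilityMeasure P]
    (hX : IsSolution P a b ξ X) (hρ : IsWeaklyStationary P X ρ)
    (hS0 : CondS0 P a b ξ) (hS1 : CondS1 P b ξ) (hS2 : CondS2 P b ξ) (k : ℤ) :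
    ∃ g, StronglyMeasurable[sigmaOn (centred P ξ) (Set.Iio k)] g ∧ volatility a b X k =ᵐ[P] g := by
  have hzs := summable_z hX.lam_nonneg hX.b_nonneg hS1.1 hS1.2
  obtain ⟨C, hC, hCb⟩ := exists_eLpNorm_volatility_le hρ hX hS1.1
  have hvm := hX.aestronglyMeasurable_volatility hρ
  -- One constant bounds both `ς` and `η`. The bound for `η = X - λ₁ ς` comes from the triangle
  -- inequality, as independence of `ξ(k)` and `ς(k)` is not yet known.
  refine exists_stronglyMeasurable_past (c := fun j => z (lam P ξ) b (j + 1) / lam P ξ)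
    (C := eLpNorm (X 0) 2 P + ‖lam P ξ‖ₑ * C + C)
    hX.measurable_centred hX.iIndepFun_centred (hX.memLp_centred hS0.memLp)
    (hX.integral_centred hS0.memLp) hX.integral_centred_sq hvm ?_ (fun k => ?_) (fun k => ?_)
    (fun j => div_nonneg (z_nonneg hX.lam_nonneg hX.b_nonneg _) hX.lam_nonneg)
    (((summable_nat_add_iff 1).2 hzs).div_const _) ?_
    (hS2.mul_tsum_lt_one hX.lam_nonneg) (hX.ae_volatility_eq_tsum hρ hS0.lam_pos hS1) k
  · exact ENNReal.add_ne_top.2 ⟨ENNReal.add_ne_top.2 ⟨(hρ.memLp 0).eLpNorm_ne_top,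
      ENNReal.mul_ne_top enorm_ne_top hC⟩, hC⟩
  · exact (hCb k).trans le_add_self
  · have : (fun s => centred P ξ k s * volatility a b X k s) =ᵐ[P]
        X k - fun s => lam P ξ * volatility a b X k s := by
      filter_upwards [hX.ae_eq_add_innovation k] with s hs
      rw [Pi.sub_apply, hs, innovation]
      ring
    rw [eLpNorm_congr_ae this]
    refine ((eLpNorm_sub_le (hρ.memLp k).aestronglyMeasurable ((hvm k).const_mul _)
      one_le_two).trans ?_).trans le_self_add
    gcongr
    · rw [hρ.eLpNorm_eq]
    · refine (eLpNorm_const_mul_le _).trans ?_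
      gcongr
      exact hCb k
  · simp_rw [div_pow]
    exact hS2.1.div_const _

lemma memLp_volatility [IsProbabilityMeasure P]
    (hX : IsSolution P a b ξ X) (hρ : IsWeaklyStationary P X ρ)
    (hS1 : CondS1 P b ξ) (k : ℤ) : MemLp (volatility a b X k) 2 P := by
  obtain ⟨C, hC, hCb⟩ := exists_eLpNorm_volatility_le hρ hX hS1.1
  exact ⟨hX.aestronglyMeasurable_volatility hρ k, (hCb k).trans_lt hC.lt_top⟩

lemma memLp_innovation [IsProbabilityMeasure P]
    (hX : IsSolution P a b ξ X) (hρ : IsWeaklyStationary P X ρ)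
    (hS1 : CondS1 P b ξ) (k : ℤ) : MemLp (innovation P a b ξ X k) 2 P := by
  refine ((hρ.memLp k).sub ((memLp_volatility hX hρ hS1 k).const_mul (lam P ξ))).ae_eq ?_
  filter_upwards [hX.ae_eq_add_innovation k] with s hs
  rw [Pi.sub_apply, hs]
  ring

lemma indepFun_centred_of_past [IsProbabilityMeasure P]
    (hX : IsSolution P a b ξ X) {k : ℤ} {g : S → ℝ}
    (hg : StronglyMeasurable[sigmaOn (centred P ξ) (Set.Iio k)] g) :
    IndepFun (centred P ξ k) g P :=
  indepFun_of_measurable_sigmaOn hX.measurable_centred hX.iIndepFun_centred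
    (Set.disjoint_singleton_left.2 (by simp)) (measurable_sigmaOn (Set.mem_singleton k))
    hg.measurable

lemma integral_centred_mul_past [IsProbabilityMeasure P]
    (hX : IsSolution P a b ξ X) (h2 : MemLp (ξ 0) 2 P) {k : ℤ}
    {g : S → ℝ} (hg : StronglyMeasurable[sigmaOn (centred P ξ) (Set.Iio k)] g) :
    ∫ s, centred P ξ k s * g s ∂P = 0 := by
  rw [(indepFun_centred_of_past hX hg).integral_fun_mul_eq_mul_integral
    (hX.measurable_centred k).aestronglyMeasurable
    (hg.mono (sigmaOn_le hX.measurable_centred _)).aestronglyMeasurable,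
    hX.integral_centred h2, zero_mul]

lemma integral_innovation [IsProbabilityMeasure P]
    (hX : IsSolution P a b ξ X) (hρ : IsWeaklyStationary P X ρ)
    (hS0 : CondS0 P a b ξ) (hS1 : CondS1 P b ξ) (hS2 : CondS2 P b ξ) (k : ℤ) :
    ∫ s, innovation P a b ξ X k s ∂P = 0 := by
  obtain ⟨g, hg, hge⟩ := exists_volatility_ae_eq hX hρ hS0 hS1 hS2 k
  rw [← integral_centred_mul_past hX hS0.memLp hg]
  refine integral_congr_ae ?_
  filter_upwards [hge] with s hs
  rw [innovation, hs]

/-- The centred shock at time `k` factors out: the volatility at `k` and the innovation at `j < k`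
are both functions of the past. -/
lemma integral_innovation_mul_of_lt [IsProbabilityMeasure P]
    (hX : IsSolution P a b ξ X) (hρ : IsWeaklyStationary P X ρ)
    (hS0 : CondS0 P a b ξ) (hS1 : CondS1 P b ξ) (hS2 : CondS2 P b ξ) {j k : ℤ} (hjk : j < k) :
    ∫ s, innovation P a b ξ X k s * innovation P a b ξ X j s ∂P = 0 := by
  obtain ⟨g, hg, hge⟩ := exists_volatility_ae_eq hX hρ hS0 hS1 hS2 k
  obtain ⟨f, hf, hfe⟩ := exists_volatility_ae_eq hX hρ hS0 hS1 hS2 j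
  have hm : StronglyMeasurable[sigmaOn (centred P ξ) (Set.Iio k)]
      fun s => g s * (centred P ξ j s * f s) :=
    hg.mul ((measurable_sigmaOn (Set.mem_Iio.2 hjk)).stronglyMeasurable.mul
      (hf.mono (sigmaOn_mono (Set.Iio_subset_Iio hjk.le))))
  rw [← integral_centred_mul_past hX hS0.memLp hm]
  refine integral_congr_ae ?_
  filter_upwards [hge, hfe] with s h1 h2
  rw [innovation, innovation, h1, h2]
  ring

lemma integral_innovation_mul_of_ne [IsProbabilityMeasure P]
    (hX : IsSolution P a b ξ X) (hρ : IsWeaklyStationary P X ρ)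
    (hS0 : CondS0 P a b ξ) (hS1 : CondS1 P b ξ) (hS2 : CondS2 P b ξ) {j k : ℤ} (hjk : j ≠ k) :
    ∫ s, innovation P a b ξ X j s * innovation P a b ξ X k s ∂P = 0 := by
  rcases lt_or_gt_of_ne hjk with h | h
  · simp_rw [mul_comm (innovation P a b ξ X j _)]
    exact integral_innovation_mul_of_lt hX hρ hS0 hS1 hS2 h
  · exact integral_innovation_mul_of_lt hX hρ hS0 hS1 hS2 h

/-- Independence gives `E η² = σ² E ς²` and `E X² = (λ₁² + σ²) E ς²`. Eliminating `E ς²` shows that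
the variance does not depend on `k`. -/
lemma integral_innovation_sq [IsProbabilityMeasure P]
    (hX : IsSolution P a b ξ X) (hρ : IsWeaklyStationary P X ρ)
    (hS0 : CondS0 P a b ξ) (hS1 : CondS1 P b ξ) (hS2 : CondS2 P b ξ) (k : ℤ) :
    ∫ s, innovation P a b ξ X k s ^ 2 ∂P =
      sigma P ξ ^ 2 * ((∫ s, X 0 s ^ 2 ∂P) / (lam P ξ ^ 2 + sigma P ξ ^ 2)) := by
  obtain ⟨g, hg, hge⟩ := exists_volatility_ae_eq hX hρ hS0 hS1 hS2 k
  have hgm := (hg.mono (sigmaOn_le hX.measurable_centred _)).measurable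
  have hind := indepFun_centred_of_past hX hg
  have h1 : ∫ s, innovation P a b ξ X k s ^ 2 ∂P = sigma P ξ ^ 2 * ∫ s, g s ^ 2 ∂P := by
    rw [← hX.integral_centred_sq k, ← integral_mul_sq_of_indepFun (hX.measurable_centred k) hgm hind]
    refine integral_congr_ae ?_
    filter_upwards [hge] with s hs
    rw [innovation, hs]
  have h2 : ∫ s, X 0 s ^ 2 ∂P = (lam P ξ ^ 2 + sigma P ξ ^ 2) * ∫ s, g s ^ 2 ∂P := by
    have hsh : IndepFun (ξ k) g P := by
      have := hind.comp (φ := fun x => x + lam P ξ) (ψ := id) (measurable_id.add_const _)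
        measurable_id
      have e : (fun x => x + lam P ξ) ∘ centred P ξ k = ξ k := by
        funext s
        simp [centred]
      rwa [e] at this
    have h3 : ∫ s, ξ k s ^ 2 ∂P = lam P ξ ^ 2 + sigma P ξ ^ 2 := by
      have h4 := variance_eq_sub ((hX.shock_ident k).symm.memLp_snd hS0.memLp)
      rw [hX.integral_shock, (hX.shock_ident k).variance_eq] at h4
      rw [sigma, Real.sq_sqrt (variance_nonneg _ _), h4]
      simp
    rw [hρ.integral_sq_eq 0, ← hρ.integral_sq_eq k, ← h3,
      ← integral_mul_sq_of_indepFun (hX.shock_measurable k) hgm hsh]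
    refine integral_congr_ae ?_
    filter_upwards [hge, hX.equation k] with s h5 h6
    rw [h6, h5, mul_comm]
  rw [h1, h2, mul_div_cancel_left₀]
  have := hS0.lam_pos
  positivity

end

/-! ### The autocovariance formula. -/

section

lemma IsWeaklyStationary.neg_eq {S : Type*} [MeasurableSpace S] {P : Measure S} {X : ℤ → S → ℝ}
    {ρ : ℤ → ℝ} (hρ : IsWeaklyStationary P X ρ) (k : ℤ) : ρ (-k) = ρ k := by
  rw [← hρ.cov_eq k (-k), ← hρ.cov_eq 0 k, add_neg_cancel, zero_add, covariance_comm]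

variable {S : Type*} [MeasurableSpace S] {P : Measure S} [IsProbabilityMeasure P]
  {a : ℝ} {b : ℕ → ℝ} {ξ X : ℤ → S → ℝ} {ρ : ℤ → ℝ}

/-- The variance of the innovations. -/
noncomputable def innovationVariance (P : Measure S) (ξ X : ℤ → S → ℝ) : ℝ :=
  sigma P ξ ^ 2 * ((∫ s, X 0 s ^ 2 ∂P) / (lam P ξ ^ 2 + sigma P ξ ^ 2))

lemma integral_norm_innovation_mul_le (hX : IsSolution P a b ξ X) (hρ : IsWeaklyStationary P X ρ)
    (hS0 : CondS0 P a b ξ) (hS1 : CondS1 P b ξ) (hS2 : CondS2 P b ξ) (j k : ℤ) :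
    ∫ s, ‖innovation P a b ξ X j s * innovation P a b ξ X k s‖ ∂P ≤ innovationVariance P ξ X := by
  have hj := memLp_innovation hX hρ hS1 j
  have hk := memLp_innovation hX hρ hS1 k
  have hb : ∀ s, ‖innovation P a b ξ X j s * innovation P a b ξ X k s‖ ≤
      (innovation P a b ξ X j s ^ 2 + innovation P a b ξ X k s ^ 2) / 2 := by
    intro s
    rw [norm_mul, Real.norm_eq_abs, Real.norm_eq_abs, ← sq_abs (innovation P a b ξ X j s),
      ← sq_abs (innovation P a b ξ X k s)]
    nlinarith [sq_nonneg (|innovation P a b ξ X j s| - |innovation P a b ξ X k s|)]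
  refine (integral_mono (hj.integrable_mul hk).norm
    ((hj.integrable_sq.add hk.integrable_sq).div_const 2) hb).trans_eq ?_
  rw [integral_div, integral_add' hj.integrable_sq hk.integrable_sq,
    integral_innovation_sq hX hρ hS0 hS1 hS2, integral_innovation_sq hX hρ hS0 hS1 hS2,
    innovationVariance]
  ring

lemma integral_solution (hX : IsSolution P a b ξ X) (hρ : IsWeaklyStationary P X ρ)
    (hS0 : CondS0 P a b ξ) (hS1 : CondS1 P b ξ) (hS2 : CondS2 P b ξ) (k : ℤ) :
    ∫ s, X k s ∂P = lam P ξ * (a * ∑' j, z (lam P ξ) b j) := by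
  have hz0 := z_nonneg hX.lam_nonneg hX.b_nonneg
  have hzs := summable_z hX.lam_nonneg hX.b_nonneg hS1.1 hS1.2
  have hi : ∀ j : ℕ, Integrable (fun s => z (lam P ξ) b j * innovation P a b ξ X (k - j) s) P :=
    fun j => ((memLp_innovation hX hρ hS1 _).integrable one_le_two).const_mul _
  have hsum : Summable fun j : ℕ =>
      ∫ s, ‖z (lam P ξ) b j * innovation P a b ξ X (k - j) s‖ ∂P := by
    refine Summable.of_nonneg_of_le (fun j => integral_nonneg fun s => norm_nonneg _) (fun j => ?_)
      (hzs.mul_right ((innovationVariance P ξ X + 1) / 2))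
    simp_rw [norm_mul, Real.norm_of_nonneg (hz0 j)]
    rw [integral_const_mul]
    refine mul_le_mul_of_nonneg_left ?_ (hz0 j)
    have hm := memLp_innovation hX hρ hS1 (k - j)
    have hb : ∀ s, ‖innovation P a b ξ X (k - j) s‖ ≤
        (innovation P a b ξ X (k - j) s ^ 2 + 1) / 2 := by
      intro s
      rw [Real.norm_eq_abs, ← sq_abs (innovation P a b ξ X (k - j) s)]
      nlinarith [sq_nonneg (|innovation P a b ξ X (k - j) s| - 1)]
    refine (integral_mono (hm.integrable one_le_two).norm
      ((hm.integrable_sq.add (integrable_const 1)).div_const 2) hb).trans_eq ?_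
    rw [integral_div, integral_add' hm.integrable_sq (integrable_const 1),
      integral_innovation_sq hX hρ hS0 hS1 hS2, innovationVariance]
    simp
  have h1 := integral_tsum_of_summable_integral_norm hi hsum
  simp_rw [integral_const_mul, integral_innovation hX hρ hS0 hS1 hS2, mul_zero, tsum_zero] at h1
  have hts : Integrable
      (fun s => ∑' j : ℕ, z (lam P ξ) b j * innovation P a b ξ X (k - j) s) P := by
    refine ((hρ.memLp k).integrable one_le_two).sub
      (integrable_const (lam P ξ * (a * ∑' j, z (lam P ξ) b j))) |>.congr ?_
    filter_upwards [hX.ae_eq_tsum_innovation hρ hS1 k] with s hs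
    rw [Pi.sub_apply, hs.2, add_sub_cancel_left]
  rw [integral_congr_ae ((hX.ae_eq_tsum_innovation hρ hS1 k).mono fun s hs => hs.2),
    integral_add (integrable_const _) hts, ← h1]
  simp

/-- Positivity of `a` and `λ₁` makes the mean of `X`, hence its second moment, positive. -/
lemma innovationVariance_pos (hX : IsSolution P a b ξ X) (hρ : IsWeaklyStationary P X ρ)
    (hS0 : CondS0 P a b ξ) (hS1 : CondS1 P b ξ) (hS2 : CondS2 P b ξ) :
    0 < innovationVariance P ξ X := by
  have hz0 := z_nonneg hX.lam_nonneg hX.b_nonneg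
  have hzs := summable_z hX.lam_nonneg hX.b_nonneg hS1.1 hS1.2
  have hl := hS0.lam_pos
  have hs := hS0.sigma_pos
  have ha := hS0.a_pos
  have hZ : 0 < ∑' j, z (lam P ξ) b j :=
    hzs.tsum_pos hz0 0 (by rw [z_zero]; exact one_pos)
  have h1 : 0 < ∫ s, X 0 s ∂P := by
    rw [integral_solution hX hρ hS0 hS1 hS2]
    positivity
  have h2 := variance_eq_sub (hρ.memLp 0)
  have h3 := variance_nonneg (X 0) P
  have h4 : 0 < ∫ s, X 0 s ^ 2 ∂P := by
    have h5 : 0 < (∫ s, X 0 s ∂P) ^ 2 := by positivity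
    simp only [Pi.pow_apply] at h2
    linarith
  unfold innovationVariance
  positivity

/-- The autocovariance function of a weakly stationary solution. -/
theorem autocovariance_eq (hX : IsSolution P a b ξ X) (hρ : IsWeaklyStationary P X ρ)
    (hS0 : CondS0 P a b ξ) (hS1 : CondS1 P b ξ) (hS2 : CondS2 P b ξ) (n : ℕ) :
    ρ n = innovationVariance P ξ X * ∑' i, z (lam P ξ) b i * z (lam P ξ) b (i + n) := by
  set l := lam P ξ with hl
  have hz0 := z_nonneg hX.lam_nonneg hX.b_nonneg
  have hzs := summable_z hX.lam_nonneg hX.b_nonneg hS1.1 hS1.2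
  set F : ℕ × ℕ → S → ℝ := fun p s => z l b p.1 * z l b p.2 *
    (innovation P a b ξ X (0 - p.1) s * innovation P a b ξ X (n - p.2) s) with hF
  have hzz : Summable fun p : ℕ × ℕ => z l b p.1 * z l b p.2 :=
    hzs.mul_of_nonneg hzs hz0 hz0
  have hFi : ∀ p, Integrable (F p) P := fun p =>
    ((memLp_innovation hX hρ hS1 _).integrable_mul (memLp_innovation hX hρ hS1 _)).const_mul _
  have hFs : Summable fun p => ∫ s, ‖F p s‖ ∂P := by
    refine Summable.of_nonneg_of_le (fun p => integral_nonneg fun s => norm_nonneg _) (fun p => ?_)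
      (hzz.mul_right (innovationVariance P ξ X))
    have e : ∀ s, ‖F p s‖ = z l b p.1 * z l b p.2 *
        ‖innovation P a b ξ X (0 - p.1) s * innovation P a b ξ X (n - p.2) s‖ := fun s => by
      rw [hF, norm_mul, Real.norm_of_nonneg (mul_nonneg (hz0 p.1) (hz0 p.2))]
    simp_rw [e]
    rw [integral_const_mul]
    exact mul_le_mul_of_nonneg_left (integral_norm_innovation_mul_le hX hρ hS0 hS1 hS2 _ _)
      (mul_nonneg (hz0 _) (hz0 _))
  have h1 := integral_tsum_of_summable_integral_norm hFi hFs
  have h2 : ρ n = ∫ s, ∑' p, F p s ∂P := by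
    rw [← hρ.cov_eq 0 n, zero_add, covariance]
    refine integral_congr_ae ?_
    filter_upwards [hX.ae_eq_tsum_innovation hρ hS1 0, hX.ae_eq_tsum_innovation hρ hS1 n]
      with s h3 h4
    rw [integral_solution hX hρ hS0 hS1 hS2, integral_solution hX hρ hS0 hS1 hS2, h3.2, h4.2,
      add_sub_cancel_left, add_sub_cancel_left,
      tsum_mul_tsum_of_summable_norm h3.1.norm h4.1.norm]
    refine tsum_congr fun p => ?_
    rw [hF]
    ring
  -- Orthogonality keeps only the pairs with equal times, `0 - p.1 = n - p.2`.
  have h3 : ∀ p, ∫ s, F p s ∂P =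
      if p.2 = p.1 + n then innovationVariance P ξ X * (z l b p.1 * z l b p.2) else 0 := by
    intro p
    rw [hF, integral_const_mul]
    split_ifs with h
    · have : ((n : ℤ) - (p.2 : ℤ)) = 0 - p.1 := by rw [h]; push_cast; ring
      simp_rw [this, ← sq]
      rw [integral_innovation_sq hX hρ hS0 hS1 hS2, ← innovationVariance, mul_comm]
    · rw [integral_innovation_mul_of_ne hX hρ hS0 hS1 hS2 (by omega), mul_zero]
  have h4 : Summable fun p => ∫ s, F p s ∂P :=
    hFs.of_norm_bounded fun p => norm_integral_le_integral_norm _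
  rw [h2, ← h1, h4.tsum_prod, ← tsum_mul_left]
  refine tsum_congr fun i => ?_
  simp_rw [h3]
  rw [tsum_eq_single (i + n) fun j hj => if_neg hj, if_pos rfl]

end

/-! ### Transfer of decay between `b` and the autocovariance. -/

/-- The lower bound keeps the term `i = 0`; the upper bound replaces `z (i + n)` by `M`. -/
lemma autocovariance_bounds {z : ℕ → ℝ} (hz0 : ∀ n, 0 ≤ z n) (hzs : Summable z) (hz1 : z 0 = 1)
    (n : ℕ) {M : ℝ} (hM : ∀ i, n ≤ i → z i ≤ M) :
    z n ≤ ∑' i, z i * z (i + n) ∧ ∑' i, z i * z (i + n) ≤ (∑' i, z i) * M := by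
  have hle : ∀ i, z i * z (i + n) ≤ z i * M := fun i =>
    mul_le_mul_of_nonneg_left (hM _ (by omega)) (hz0 i)
  have hs : Summable fun i => z i * z (i + n) :=
    Summable.of_nonneg_of_le (fun i => mul_nonneg (hz0 _) (hz0 _)) hle (hzs.mul_right M)
  refine ⟨?_, ?_⟩
  · have := hs.le_tsum 0 fun i _ => mul_nonneg (hz0 _) (hz0 _)
    simpa [hz1] using this
  · rw [← tsum_mul_right]
    exact hs.tsum_le_tsum hle (hzs.mul_right M)

section

variable {l s : ℝ} {b r : ℕ → ℝ}

lemma le_const_mul_autocovariance (hl : 0 < l) (hs : 0 < s) (hb : ∀ j, 1 ≤ j → 0 ≤ b j)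
    (hbs : Summable fun j => b (j + 1)) (h1 : l * ∑' j, b (j + 1) < 1)
    (hr : ∀ n, r n = s * ∑' i, z l b i * z l b (i + n)) {n : ℕ} (hn : 1 ≤ n) :
    b n ≤ (s * l)⁻¹ * r n := by
  obtain ⟨m, rfl⟩ : ∃ m, n = m + 1 := ⟨n - 1, by omega⟩
  have hz0 := z_nonneg hl.le hb
  have hzs := summable_z hl.le hb hbs h1
  have h2 := (autocovariance_bounds hz0 hzs (z_zero l b) (m + 1)
    (M := ∑' i, z l b i) fun i _ => hzs.le_tsum i fun j _ => hz0 j).1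
  have h3 := le_z hl.le hb m
  have h4 : s * (l * b (m + 1)) ≤ r (m + 1) := by
    rw [hr]
    exact mul_le_mul_of_nonneg_left (h3.trans h2) hs.le
  rw [inv_mul_eq_div, le_div_iff₀ (mul_pos hs hl)]
  linarith

lemma limsup_logRatio_autocovariance_le (hl : 0 < l) (hs : 0 < s) (hb : ∀ j, 1 ≤ j → 0 ≤ b j)
    (hbs : Summable fun j => b (j + 1)) (h1 : l * ∑' j, b (j + 1) < 1)
    (hr : ∀ n, r n = s * ∑' i, z l b i * z l b (i + n))
    (hlt : limsup (logRatio b) atTop < 0) :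
    limsup (logRatio r) atTop ≤ limsup (logRatio b) atTop := by
  have hz0 := z_nonneg hl.le hb
  have hzs := summable_z hl.le hb hbs h1
  refine EReal.le_of_forall_lt_iff_le.1 fun t ht => ?_
  -- A negative `q` supplies the non-negative decay exponent `-q` for `z_le_rpow` and makes `n ^ q`
  -- bound all later powers.
  obtain ⟨q, hq1, hq2⟩ := EReal.exists_between_coe_real (lt_min ht hlt)
  have hq0 : q < 0 := EReal.coe_lt_coe_iff.1 (hq2.trans_le (min_le_right _ _))
  have hqt : q < t := EReal.coe_lt_coe_iff.1 (hq2.trans_le (min_le_left _ _))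
  obtain ⟨N, hN⟩ := eventually_atTop.1 (eventually_le_rpow_of_limsup_logRatio_lt hq1)
  -- The eventual bound becomes global by adding the finitely many exceptional ratios to the
  -- constant.
  obtain ⟨K, hK1, hK⟩ : ∃ K : ℝ, 1 ≤ K ∧ ∀ j : ℕ, b (j + 1) ≤ K * ((j : ℝ) + 1) ^ q := by
    have hnn : ∀ j : ℕ, 0 ≤ b (j + 1) / ((j : ℝ) + 1) ^ q := fun j =>
      div_nonneg (hb _ (by omega)) (Real.rpow_nonneg (by positivity) _)
    have hsum : 0 ≤ ∑ j ∈ Finset.range N, b (j + 1) / ((j : ℝ) + 1) ^ q :=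
      Finset.sum_nonneg fun j _ => hnn j
    refine ⟨1 + ∑ j ∈ Finset.range N, b (j + 1) / ((j : ℝ) + 1) ^ q, by linarith, fun j => ?_⟩
    have hp : 0 < ((j : ℝ) + 1) ^ q := Real.rpow_pos_of_pos (by positivity) _
    rw [← div_le_iff₀ hp]
    by_cases hj : j < N
    · have := Finset.single_le_sum (fun i _ => hnn i) (Finset.mem_range.2 hj)
      linarith
    · have := hN (j + 1) (by omega)
      push_cast at this
      have : b (j + 1) / ((j : ℝ) + 1) ^ q ≤ 1 := by rwa [div_le_one hp]
      linarith
  obtain ⟨M, hM⟩ := z_le_rpow hl.le hb hbs h1 (γ := -q) (K := K) (by linarith)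
    (by simpa only [neg_neg] using hK)
  simp only [neg_neg] at hM
  have hM0 : 0 ≤ M := by
    have := (hz0 0).trans (hM 0)
    simpa using this
  have hqt' : ((q : ℝ) : EReal) ≤ t := by exact_mod_cast hqt.le
  refine le_trans (limsup_logRatio_le_of_le_rpow (K := s * ((∑' i, z l b i) * M)) ?_) hqt'
  filter_upwards [eventually_ge_atTop 1] with n hn
  have hn0 : (0 : ℝ) < n := by exact_mod_cast hn
  have h2 := (autocovariance_bounds hz0 hzs (z_zero l b) n (M := M * (n : ℝ) ^ q)
    fun i hi => (hM i).trans (mul_le_mul_of_nonneg_left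
      (Real.rpow_le_rpow_of_nonpos hn0 (by
        have : (n : ℝ) ≤ i := by exact_mod_cast hi
        linarith) hq0.le) hM0)).2
  rw [hr]
  have := mul_le_mul_of_nonneg_left h2 hs.le
  linarith

end

end ArchInfty

theorem theorem5p6 {S : Type*} [MeasurableSpace S] (P : Measure S) [IsProbabilityMeasure P]
    (a : ℝ) (b : ℕ → ℝ) (ξ X : ℤ → S → ℝ) (ρ : ℤ → ℝ)
    (hX : ArchInfty.IsSolution P a b ξ X)
    (hρ : ArchInfty.IsWeaklyStationary P X ρ)
    (hS0 : ArchInfty.CondS0 P a b ξ)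
    (hS1 : ArchInfty.CondS1 P b ξ)
    (hS2 : ArchInfty.CondS2 P b ξ)
    (β : EReal) (hβ : 1 < β) :
    (∀ k : ℤ, 0 ≤ ρ k) ∧
    (Tendsto (ArchInfty.logRatio b) atTop (𝓝 (-β)) →
      Tendsto (ArchInfty.logRatio fun n : ℕ => ρ n) atTop (𝓝 (-β))) ∧
    (limsup (ArchInfty.logRatio b) atTop = -β ↔
      limsup (ArchInfty.logRatio fun n : ℕ => ρ n) atTop = -β) := by
  have hr := ArchInfty.autocovariance_eq hX hρ hS0 hS1 hS2
  have hs := ArchInfty.innovationVariance_pos hX hρ hS0 hS1 hS2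
  have hl := hS0.lam_pos
  have hz0 := ArchInfty.z_nonneg hl.le hX.b_nonneg
  have hK : 0 ≤ (ArchInfty.innovationVariance P ξ X * ArchInfty.lam P ξ)⁻¹ := by positivity
  have hle : ∀ᶠ n : ℕ in atTop,
      b n ≤ (ArchInfty.innovationVariance P ξ X * ArchInfty.lam P ξ)⁻¹ * ρ n := by
    filter_upwards [eventually_ge_atTop 1] with n hn
    exact ArchInfty.le_const_mul_autocovariance hl hs hX.b_nonneg hS1.1 hS1.2 hr hn
  have hsup := ArchInfty.limsup_logRatio_mono hK hle
  have hinf := ArchInfty.liminf_logRatio_mono hK hle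
  have hβ0 : -β < 0 := by
    rw [EReal.neg_lt_comm, neg_zero]
    exact one_pos.trans hβ
  have hup : limsup (ArchInfty.logRatio b) atTop ≤ -β →
      limsup (ArchInfty.logRatio fun n : ℕ => ρ n) atTop ≤ limsup (ArchInfty.logRatio b) atTop :=
    fun h => ArchInfty.limsup_logRatio_autocovariance_le hl hs hX.b_nonneg hS1.1 hS1.2 hr
      (h.trans_lt hβ0)
  refine ⟨fun k => ?_, fun h => ?_, fun h => ?_, fun h => ?_⟩
  · have hnat : ∀ n : ℕ, 0 ≤ ρ n := fun n => by
      rw [hr]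
      exact mul_nonneg hs.le (tsum_nonneg fun i => mul_nonneg (hz0 _) (hz0 _))
    obtain ⟨n, rfl | rfl⟩ := k.eq_nat_or_neg
    · exact hnat n
    · rw [hρ.neg_eq]
      exact hnat n
  · refine tendsto_of_le_liminf_of_limsup_le ?_ ((hup h.limsup_eq.le).trans h.limsup_eq.le)
    exact h.liminf_eq.ge.trans hinf
  · exact le_antisymm ((hup h.le).trans h.le) (h.ge.trans hsup)
  -- The lower bound on `ρ` first forces `limsup` of the ratios of `b` below zero, which is what the
  -- upper bound on `ρ` requires.
  · have h2 : limsup (ArchInfty.logRatio b) atTop ≤ -β := hsup.trans h.le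
    exact le_antisymm h2 (h.ge.trans (hup h2))
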